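/- **Theorem (contextual bandit margin bound).** Let $\mathcal X$ be a set of contexts, $K\ge 1$, $\mathcal A=\{1,\dots,K\}$, $T\in\mathbb N$, and let $\mathcal F$ be a class of functions $f:\mathcal X\to\{s\in\mathbb R^K:\sum_a s_a=0\}$. In each round $t=1,\dots,T$ an adversary, who may be randomized and may adapt to the past actions $a_1,\dots,a_{t-1}$, chooses a context $x_t\in\mathcal X$ and a loss vector $\ell_t\in[0,1]^K$; the learner observes $x_t$, draws an action $a_t$ from a distribution that depends on $x_t$ and on $(x_s,a_s,\ell_s(a_s))_{s<t}$, and observes only $\ell_t(a_t)$. For $\gamma>0$ put $$L_T^\gamma(f)=\sum_{t=1}^T\sum_{a\in\mathcal A}\ell_t(a)\,\mathbf 1\{f(x_t)_a\ge-\gamma\}.$$ A $\mathcal Z$-valued tree $\mathbf z$ of length $T$ is a sequence of maps $\mathbf z_t:\{\pm1\}^{t-1}\to\mathcal Z$, $t=1,\dots,T$; write $\mathbf z_t(\epsilon)=\mathbf z_t(\epsilon_1,\dots,\epsilon_{t-1})$ for $\epsilon\in\{\pm1\}^T$. For an $\mathcal X$-valued tree $\mathbf x$ of length $T$ let $\mathcal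 N_{\infty,\infty}(\varepsilon,\mathcal F,\mathbf x)\in\{0,1,\dots,\infty\}$ be the smallest cardinality of a set $V$ of $\mathbb R^K$-valued trees such that for all $f\in\mathcal F$ and $\epsilon\in\{\pm1\}^T$ there is $\mathbf v\in V$ with $\max_{t\le T}\|f(\mathbf x_t(\epsilon))-\mathbf v_t(\epsilon)\|_\infty\le\varepsilon$, and let $\mathcal N_{\infty,\infty}(\varepsilon,\mathcal F,T)=\sup_{\mathbf x}\mathcal N_{\infty,\infty}(\varepsilon,\mathcal F,\mathbf x)$. Then for all constants $\beta>\alpha>0$, $\mu\in(0,1)$ and $\gamma>0$ there is a strategy of the learner such that, against every such adversary, $$\begin{aligned}\mathbb E\Big[\sum_{t=1}^T\ell_t(a_t)\Big]\le{}&\inf_{f\in\mathcal F}\mathbb E\big[L_T^\gamma(f)\big]+4\sqrt{2K^2T\log\mathcal N_{\infty,\infty}(\beta/2,\mathcal F,T)}+\mu KT+\frac8\mu\log\mathcal N_{\infty,\infty}(\beta/2,\mathcal F,T)\\&+\frac1\gamma\Big(3e^2\alpha KT+24e\sqrt{\frac{KT}{\mu}}\int_\alpha^\beta\sqrt{\log\mathcal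 N_{\infty,\infty}(\varepsilon,\mathcal F,T)}\,d\varepsilon\Big).\end{aligned}$$ -/

import Mathlib

open scoped ENNReal

namespace ContextualBandit

/-! ### Trees and sequential covering numbers -/

/-- A complete binary tree of length `T` with nodes labelled by elements of `Z`: the level with
(zero-based) index `t` is a map `{±1}^t → Z`. The signs `±1` are the units of `ℤ`. -/
def Tree (Z : Type*) (T : ℕ) : Type _ := (t : Fin T) → (Fin (t : ℕ) → ℤˣ) → Z

/-- The label of the node at level `t` on the path `ε`. It depends only on the signs before `t`. -/
def Tree.value {Z : Type*} {T : ℕ} (z : Tree Z T) (ε : Fin T → ℤˣ) (t : Fin T) : Z :=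
  z t fun i => ε (Fin.castLE t.isLt.le i)

/-- `V` is a sequential `L_∞ / ℓ_∞` cover of `G` on the tree `x` at scale `r`. The norm on
`Fin K → ℝ` is the sup norm, and the element of `V` may depend on the path. -/
def IsSeqCover {X : Type*} {K T : ℕ} (r : ℝ) (G : Set (X → Fin K → ℝ)) (x : Tree X T)
    (V : Set (Tree (Fin K → ℝ) T)) : Prop :=
  ∀ g ∈ G, ∀ ε : Fin T → ℤˣ, ∃ v ∈ V, ∀ t : Fin T, ‖g (x.value ε t) - v.value ε t‖ ≤ r

/-- The covering number of `G` on the tree `x` at scale `r`: the least cardinality of a cover,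
`⊤` if there is no finite one. -/
noncomputable def seqCoveringNumberOn {X : Type*} {K T : ℕ} (r : ℝ) (G : Set (X → Fin K → ℝ))
    (x : Tree X T) : ℕ∞ :=
  ⨅ (V : Set (Tree (Fin K → ℝ) T)) (_ : IsSeqCover r G x V), V.encard

/-- The covering number of `G` at scale `r` for length `T`: the supremum over all trees. -/
noncomputable def seqCoveringNumber {X : Type*} {K : ℕ} (r : ℝ) (G : Set (X → Fin K → ℝ))
    (T : ℕ) : ℕ∞ :=
  ⨆ x : Tree X T, seqCoveringNumberOn r G x

/-- The sequential metric entropy `log N(r, G, T)`, with value `⊤` if the covering number is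
infinite. (The truncation at `0` matters only if the covering number is `0`, which does not
happen if `G` and the set of trees are nonempty.) -/
noncomputable def seqEntropy {X : Type*} {K : ℕ} (r : ℝ) (G : Set (X → Fin K → ℝ))
    (T : ℕ) : ℝ≥0∞ :=
  (ENNReal.log (seqCoveringNumber r G T : ℝ≥0∞)).toENNReal

/-! ### The bandit protocol -/

/-- A (randomized) bandit strategy: in round `t` it maps the contexts, the chosen actions and the
observed losses `(x_s, a_s, ℓ_s(a_s))` of the rounds `s < t`, and the current context `x_t`, to
the distribution of the action `a_t`. -/
def Strategy (X : Type*) (K : ℕ) : Type _ :=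
  (t : ℕ) → (Fin t → X × Fin K × ℝ) → X → PMF (Fin K)

/-- An adaptive adversary: in round `t` it chooses the context `x_t` and the loss vector
`ℓ_t ∈ [0,1]^K`, knowing the actions of the rounds before `t`. -/
structure Adversary (X : Type*) (K : ℕ) where
  context : (t : ℕ) → (Fin t → Fin K) → X
  loss : (t : ℕ) → (Fin t → Fin K) → Fin K → ℝ
  loss_mem : ∀ t a i, loss t a i ∈ Set.Icc (0 : ℝ) 1

/-- The first `s` actions of a sequence of `T` actions. -/
def before {K T : ℕ} (a : Fin T → Fin K) (s : Fin T) : Fin (s : ℕ) → Fin K :=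
  fun i => a (Fin.castLE s.isLt.le i)

/-- The context of round `s` when the actions are `a`. -/
def Adversary.contextAt {X : Type*} {K T : ℕ} (A : Adversary X K) (a : Fin T → Fin K)
    (s : Fin T) : X :=
  A.context s (before a s)

/-- The loss vector of round `s` when the actions are `a`. -/
def Adversary.lossAt {X : Type*} {K T : ℕ} (A : Adversary X K) (a : Fin T → Fin K)
    (s : Fin T) : Fin K → ℝ :=
  A.loss s (before a s)

/-- What the learner has seen after the actions `a`: contexts, actions and losses incurred. -/
def Adversary.feedback {X : Type*} {K T : ℕ} (A : Adversary X K) (a : Fin T → Fin K) :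
    Fin T → X × Fin K × ℝ :=
  fun s => (A.contextAt a s, a s, A.lossAt a s (a s))

/-- The law of the actions `(a_1, …, a_T)` when the strategy `S` plays against `A`. -/
noncomputable def actionLaw {X : Type*} {K : ℕ} (S : Strategy X K) (A : Adversary X K) :
    (T : ℕ) → PMF (Fin T → Fin K)
  | 0 => PMF.pure Fin.elim0
  | t + 1 => (actionLaw S A t).bind fun a =>
      (S t (A.feedback a) (A.context t a)).map fun b => Fin.snoc (α := fun _ => Fin K) a b

/-- The cumulative loss `∑ t, ℓ_t(a_t)` of the learner. -/
def Adversary.cumLoss {X : Type*} {K T : ℕ} (A : Adversary X K) (a : Fin T → Fin K) : ℝ :=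
  ∑ t : Fin T, A.lossAt a t (a t)

open Classical in
/-- The margin-based cumulative loss `∑ t, ∑ i, ℓ_t(i) 1{f(x_t)_i ≥ -γ}` of the regressor `f`. -/
noncomputable def Adversary.marginLoss {X : Type*} {K T : ℕ} (A : Adversary X K) (γ : ℝ)
    (f : X → Fin K → ℝ) (a : Fin T → Fin K) : ℝ :=
  ∑ t : Fin T, ∑ i : Fin K, A.lossAt a t i * (if -γ ≤ f (A.contextAt a t) i then 1 else 0)

/-- The expectation of a nonnegative function `Φ` of the adversary's moves and the actions of the
first `T` rounds, when the adversary is randomized: it draws a seed `ω` from `P` before the game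
(unseen by the learner) and then plays `A ω`. For each seed this is a finite sum over action
sequences. -/
noncomputable def expectation {X Ω : Type*} {K : ℕ} [MeasurableSpace Ω]
    (P : MeasureTheory.Measure Ω) (S : Strategy X K) (A : Ω → Adversary X K) (T : ℕ)
    (Φ : Adversary X K → (Fin T → Fin K) → ℝ) : ℝ≥0∞ :=
  ∫⁻ ω, ∑ a : Fin T → Fin K, actionLaw S (A ω) T a * ENNReal.ofReal (Φ (A ω) a) ∂P

end ContextualBandit

-- The coordinates of `f x` sum to zero, so one of them is nonnegative. A ramp (0 below `-γ`, 1
-- above 0) therefore turns `f x` into weights in `[0,1]^K` of mass at least 1, whose cumulative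
-- loss is at most the margin loss. It suffices to compete with these weights. The learner picks a
-- weight vector `s` of the same kind, normalizes it and mixes in probability `μ` for each action,
-- so that importance-weighted loss estimates `y` lie in `[0, 1/μ]`. Regret is transferred to a
-- linear game on estimates in which the learner is charged only `y - η y²` and a penalty `λ y² + ζ
-- y` is granted. The price is at most `K(μ + 2ηK + λ/μ + ζ)` per round (`round_cost_le`).
--
-- The linear game is solved nonconstructively. The invariant `Dominated` says that the remaining
-- budget bounds the value of a symmetrized game on trees. By minimax and symmetrization some
-- response preserves it whatever the estimate (`Dominated.exists_response`), and when no rounds are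
-- left it is a regret bound.
--
-- The initial value is bounded by chaining (`pathMean_chaining_le`, `dominated_of_entropy`). With
-- `v` the ramp value at the estimated coordinate, the process is a signed `v(2y - ηy²)` with offset
-- `-ηvy² - λy² - ζy`. The coarsest net lies below `v`; its elements satisfy `w² ≤ w`, so `ηvy²`
-- absorbs their variance at cost `(2/η) log N(β/2)`, free of `γ`. The links, of size about `β/(2^j
-- γ)`, are paid by `λy²`, the residual by `ζy`. Tuning `η` and `λ` yields the square root term and
-- a Riemann sum of the entropy integral.

namespace ContextualBandit

/-! ### Trees and averages over sign paths -/

/-- The tree with root label `z` and subtree `l e` below the edge with sign `e`. -/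
def Tree.cons {Z : Type*} {n : ℕ} (z : Z) (l : ℤˣ → Tree Z n) : Tree Z (n + 1) := fun t =>
  Fin.cases (motive := fun t : Fin (n + 1) => (Fin (t : ℕ) → ℤˣ) → Z) (fun _ => z)
    (fun t (p : Fin ((t : ℕ) + 1) → ℤˣ) => l (p 0) t fun i => p i.succ) t

/-- The subtree below the edge with sign `e` at the root. -/
def Tree.child {Z : Type*} {n : ℕ} (z : Tree Z (n + 1)) (e : ℤˣ) : Tree Z n :=
  fun t p => z t.succ (Fin.cons e p : Fin ((t : ℕ) + 1) → ℤˣ)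

/-- Relabelling a tree along a function. -/
def Tree.map {Z Y : Type*} {n : ℕ} (h : Z → Y) (z : Tree Z n) : Tree Y n := fun t p => h (z t p)

theorem Tree.value_map {Z Y : Type*} {n : ℕ} (h : Z → Y) (z : Tree Z n) (ε : Fin n → ℤˣ)
    (t : Fin n) : (z.map h).value ε t = h (z.value ε t) := rfl

theorem Tree.value_cons_zero {Z : Type*} {n : ℕ} (z : Z) (l : ℤˣ → Tree Z n)
    (ε : Fin (n + 1) → ℤˣ) : (Tree.cons z l).value ε 0 = z := rfl

theorem Tree.value_cons_succ {Z : Type*} {n : ℕ} (z : Z) (l : ℤˣ → Tree Z n)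
    (e : ℤˣ) (ε : Fin n → ℤˣ) (t : Fin n) :
    (Tree.cons z l).value (Fin.cons e ε : Fin (n + 1) → ℤˣ) t.succ = (l e).value ε t := rfl

theorem Tree.value_zero_cons {Z : Type*} {n : ℕ} (z : Tree Z (n + 1)) (e : ℤˣ) (ε : Fin n → ℤˣ)
    (ε' : Fin (n + 1) → ℤˣ) :
    z.value (Fin.cons e ε : Fin (n + 1) → ℤˣ) 0 = z.value ε' 0 := by
  unfold Tree.value
  congr 1
  funext i
  exact i.elim0

theorem Tree.value_succ_cons {Z : Type*} {n : ℕ} (z : Tree Z (n + 1)) (e : ℤˣ) (ε : Fin n → ℤˣ)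
    (t : Fin n) :
    z.value (Fin.cons e ε : Fin (n + 1) → ℤˣ) t.succ = (z.child e).value ε t := by
  unfold Tree.value Tree.child
  congr 1
  funext i
  refine Fin.cases ?_ (fun j => ?_) i <;> rfl

/-- The mean of `G` over uniformly random signs. -/
noncomputable def pathMean (n : ℕ) (G : (Fin n → ℤˣ) → ℝ) : ℝ := (∑ ε, G ε) / 2 ^ n

theorem pathMean_zero (G : (Fin 0 → ℤˣ) → ℝ) : pathMean 0 G = G Fin.elim0 := by
  simp only [pathMean, Fintype.sum_unique, pow_zero, div_one]
  exact congrArg G (Subsingleton.elim _ _)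

theorem pathMean_succ (n : ℕ) (G : (Fin (n + 1) → ℤˣ) → ℝ) :
    pathMean (n + 1) G = (pathMean n (fun ε => G (Fin.cons 1 ε : Fin (n + 1) → ℤˣ)) +
      pathMean n (fun ε => G (Fin.cons (-1) ε : Fin (n + 1) → ℤˣ))) / 2 := by
  have h : ∑ ε, G ε = ∑ e : ℤˣ, ∑ ε : Fin n → ℤˣ, G (Fin.cons e ε : Fin (n + 1) → ℤˣ) := by
    rw [← (Fin.consEquiv (fun _ : Fin (n + 1) => ℤˣ)).sum_comp, Fintype.sum_prod_type]
    rfl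
  have h2 : ∀ k : ℤˣ → ℝ, ∑ e, k e = k 1 + k (-1) := fun k => by
    rw [show (Finset.univ : Finset ℤˣ) = {1, -1} by decide, Finset.sum_pair (by decide)]
  unfold pathMean
  rw [h, h2, pow_succ]
  field_simp

theorem pathMean_add (n : ℕ) (G H : (Fin n → ℤˣ) → ℝ) :
    pathMean n (fun ε => G ε + H ε) = pathMean n G + pathMean n H := by
  simp [pathMean, Finset.sum_add_distrib, add_div]

theorem pathMean_sub (n : ℕ) (G H : (Fin n → ℤˣ) → ℝ) :
    pathMean n (fun ε => G ε - H ε) = pathMean n G - pathMean n H := by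
  simp [pathMean, Finset.sum_sub_distrib, sub_div]

theorem pathMean_mul (n : ℕ) (b : ℝ) (G : (Fin n → ℤˣ) → ℝ) :
    pathMean n (fun ε => b * G ε) = b * pathMean n G := by
  simp [pathMean, ← Finset.mul_sum, mul_div_assoc]

theorem pathMean_const (n : ℕ) (b : ℝ) : pathMean n (fun _ => b) = b := by
  simp [pathMean]

theorem pathMean_sum {κ : Type*} (n : ℕ) (u : Finset κ) (G : κ → (Fin n → ℤˣ) → ℝ) :
    pathMean n (fun ε => ∑ k ∈ u, G k ε) = ∑ k ∈ u, pathMean n (G k) := by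
  simp only [pathMean, ← Finset.sum_div]
  rw [Finset.sum_comm]

theorem pathMean_mono (n : ℕ) {G H : (Fin n → ℤˣ) → ℝ} (h : ∀ ε, G ε ≤ H ε) :
    pathMean n G ≤ pathMean n H := by
  unfold pathMean
  gcongr
  exact h _

/-! ### A minimax theorem -/

/-- A minimax statement in which the opponent mixes only finitely many constraints, so no measure on
`I` is needed. Compactness reduces to finitely many constraints; if these had no common solution, a
separating functional would be, up to sign and scale, a mixture that every `s` fails. -/
theorem exists_forall_affine_nonpos {κ I : Type*} [Fintype κ] {S : Set (κ → ℝ)}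
    (hS : IsCompact S) (hconv : Convex ℝ S) (w : I → κ → ℝ) (b : I → ℝ)
    (h : ∀ (u : Finset I) (q : I → ℝ), (∀ i, 0 ≤ q i) → ∑ i ∈ u, q i = 1 →
      ∃ s ∈ S, ∑ i ∈ u, q i * (s ⬝ᵥ w i + b i) ≤ 0) (hne : S.Nonempty) :
    ∃ s ∈ S, ∀ i, s ⬝ᵥ w i + b i ≤ 0 := by
  classical
  have hcont : ∀ i, Continuous fun s : κ → ℝ => s ⬝ᵥ w i + b i := fun i => by
    unfold dotProduct
    fun_prop
  suffices hfin : ∀ u : Finset I, (S ∩ ⋂ i ∈ u, {s | s ⬝ᵥ w i + b i ≤ 0}).Nonempty by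
    obtain ⟨s, hs, hs'⟩ := hS.inter_iInter_nonempty (fun i => {s | s ⬝ᵥ w i + b i ≤ 0})
      (fun i => isClosed_le (hcont i) continuous_const) hfin
    exact ⟨s, hs, fun i => by simpa using Set.mem_iInter.1 hs' i⟩
  intro u
  by_contra hempty
  let Λ : (κ → ℝ) → (u → ℝ) := fun s i => s ⬝ᵥ w i + b i
  have hΛc : Continuous Λ := continuous_pi fun i => hcont i
  have hC : Convex ℝ (Λ '' S) := by
    rintro _ ⟨s, hs, rfl⟩ _ ⟨s', hs', rfl⟩ p p' hp hp' hpp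
    refine ⟨p • s + p' • s', hconv hs hs' hp hp' hpp, ?_⟩
    funext i
    simp only [Λ, add_dotProduct, smul_dotProduct, Pi.add_apply, Pi.smul_apply, smul_eq_mul]
    linear_combination -(b i) * hpp
  have hDc : Convex ℝ (Set.Iic (0 : u → ℝ)) := convex_Iic 0
  have hdisj : Disjoint (Λ '' S) (Set.Iic (0 : u → ℝ)) := by
    rw [Set.disjoint_left]
    rintro _ ⟨s, hs, rfl⟩ hz
    refine hempty ⟨s, hs, ?_⟩
    simp only [Set.mem_iInter, Set.mem_ofPred_eq]
    exact fun i hi => hz ⟨i, hi⟩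
  obtain ⟨φ, p, p', hφ1, hpp, hφ2⟩ := geometric_hahn_banach_compact_closed hC
    (hS.image hΛc) hDc isClosed_Iic hdisj
  have hp'0 : p' < 0 := by simpa using hφ2 0 (by simp)
  set θ : u → ℝ := fun i => φ (Pi.single i 1) with hθ
  have hφ : ∀ z, φ z = ∑ i, θ i * z i := fun z => by
    conv_lhs => rw [pi_eq_sum_univ' z]
    simp [map_sum, hθ, mul_comm]
  -- A positive coefficient would make the functional attain `p'` on the nonpositive orthant, where
  -- it exceeds `p'`.
  have hθ0 : ∀ i, θ i ≤ 0 := by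
    intro i
    by_contra! hi
    have := hφ2 (Pi.single i (p' / θ i)) (by
      intro j
      by_cases hj : j = i
      · subst hj
        simpa using (div_neg_of_neg_of_pos hp'0 hi).le
      · simp [hj])
    rw [hφ, Finset.sum_eq_single i (fun j _ hj => by simp [hj]) (by simp)] at this
    simp [mul_div_cancel₀ p' hi.ne'] at this
  obtain ⟨s₀, hs₀⟩ := hne
  have hneg : ∀ s ∈ S, ∑ i, θ i * Λ s i < 0 := fun s hs => by
    have := hφ1 _ (Set.mem_image_of_mem Λ hs)
    rw [hφ] at this
    linarith
  set Θ := ∑ i, -θ i with hΘ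
  have hΘpos : 0 < Θ := by
    refine lt_of_le_of_ne (Finset.sum_nonneg fun i _ => by linarith [hθ0 i]) fun h0 => ?_
    have hz := (Finset.sum_eq_zero_iff_of_nonneg
      (fun i _ => by linarith [hθ0 i] : ∀ i ∈ Finset.univ, 0 ≤ -θ i)).1 h0.symm
    have := hneg s₀ hs₀
    rw [Finset.sum_eq_zero fun i hi => by rw [neg_eq_zero.1 (hz i hi), zero_mul]] at this
    exact lt_irrefl _ this
  let q : I → ℝ := fun i => if hi : i ∈ u then -θ ⟨i, hi⟩ / Θ else 0
  have hq : ∀ i : u, q i = -θ i / Θ := fun i => by simp [q]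
  obtain ⟨s, hs, hle⟩ := h u q
    (fun i => by
      by_cases hi : i ∈ u
      · rw [hq ⟨i, hi⟩]
        exact div_nonneg (by linarith [hθ0 ⟨i, hi⟩]) hΘpos.le
      · simp [q, hi])
    (by
      rw [← Finset.sum_coe_sort]
      simp only [hq]
      rw [← Finset.sum_div, ← hΘ, div_self hΘpos.ne'])
  rw [← Finset.sum_coe_sort] at hle
  simp only [hq] at hle
  have h1 := hneg s hs
  have h2 : ∑ i : u, -θ i / Θ * (s ⬝ᵥ w i + b i) = -(∑ i, θ i * Λ s i) / Θ := by
    rw [← Finset.sum_neg_distrib, Finset.sum_div]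
    exact Finset.sum_congr rfl fun i _ => by simp only [Λ]; ring
  rw [h2] at hle
  exact absurd hle (not_le.2 (div_pos (by linarith) hΘpos))

/-! ### One round of the symmetrized game -/

section Game

variable {X E ι κ : Type*} [Fintype κ]

/-- The mean, over random signs, of the payoff of the continuation `z` of the game in which the
comparator `σ ε` is selected at the end of the path `ε`. -/
noncomputable def continuationValue (r : ℤˣ → ι → X × E → ℝ) {n : ℕ} (c : ι → ℝ)
    (z : Tree (X × E) n) (σ : (Fin n → ℤˣ) → ι) : ℝ :=
  pathMean n fun ε => c (σ ε) + ∑ t, r (ε t) (σ ε) (z.value ε t)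

/-- With `n` rounds to go and accumulated payoffs `c`, no continuation exceeds `M`. -/
def Dominated (r : ℤˣ → ι → X × E → ℝ) (n : ℕ) (c : ι → ℝ) (M : ℝ) : Prop :=
  ∀ (z : Tree (X × E) n) (σ : (Fin n → ℤˣ) → ι), continuationValue r c z σ ≤ M

theorem continuationValue_eq_add (r : ℤˣ → ι → X × E → ℝ) {n : ℕ} (c : ι → ℝ)
    (z : Tree (X × E) n) (σ : (Fin n → ℤˣ) → ι) :
    continuationValue r c z σ =
      pathMean n (fun ε => c (σ ε)) + continuationValue r (fun _ => 0) z σ := by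
  unfold continuationValue
  rw [← pathMean_add]
  simp

/-- Trees and selections may both depend on the first sign, so the two signs at the root can lead to
unrelated continuations. This is what lets two independent continuations be paired in the
symmetrization. -/
theorem Dominated.glue {r : ℤˣ → ι → X × E → ℝ} {n : ℕ} {c : ι → ℝ} {M : ℝ}
    (h : Dominated r (n + 1) c M) (m : X × E) (z z' : Tree (X × E) n)
    (σ σ' : (Fin n → ℤˣ) → ι) :
    (continuationValue r (fun i => c i + r 1 i m) z σ +
      continuationValue r (fun i => c i + r (-1) i m) z' σ') / 2 ≤ M := by
  refine le_of_eq_of_le ?_ (h (Tree.cons m fun e => if e = 1 then z else z')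
    fun ε => if ε 0 = 1 then σ (Fin.tail ε) else σ' (Fin.tail ε))
  have h1 : (-1 : ℤˣ) ≠ 1 := by decide
  unfold continuationValue
  rw [pathMean_succ]
  simp only [Fin.sum_univ_succ, Fin.cons_zero, Fin.cons_succ, Fin.tail_cons,
    Tree.value_cons_zero, Tree.value_cons_succ, if_true, if_neg h1, add_assoc]

theorem dominated_zero {r : ℤˣ → ι → X × E → ℝ} {c : ι → ℝ} {M : ℝ}
    (h : Dominated r 0 c M) (i : ι) : c i ≤ M := by
  simpa [continuationValue, pathMean_zero] using h (fun t => t.elim0) (fun _ => i)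

/-- The payoff of one round of the symmetrized game. -/
def symPayoff (g : ι → X → κ → ℝ) (u w : E → κ → ℝ) (pen : E → ℝ) :
    ℤˣ → ι → X × E → ℝ := fun e i m =>
  -- The shape is dictated by the two values: `2 g·w - pen` for the sign 1 and `-2 g·u - pen` for
  -- the sign -1.
  ((e : ℤ) : ℝ) * (g i m.1 ⬝ᵥ w m.2 + g i m.1 ⬝ᵥ u m.2)
    - (g i m.1 ⬝ᵥ u m.2 - g i m.1 ⬝ᵥ w m.2) - pen m.2

/-- Sequential symmetrization of one round: the learner can choose `s` so that the value of the
symmetrized game dominates the continuation for every move of the opponent. -/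
theorem Dominated.exists_response {S : Set (κ → ℝ)} (hS : IsCompact S) (hconv : Convex ℝ S)
    (hne : S.Nonempty) {g : ι → X → κ → ℝ} (hg : ∀ i x, g i x ∈ S) {u w : E → κ → ℝ}
    {pen : E → ℝ} {n : ℕ} {c : ι → ℝ} {M : ℝ}
    (h : Dominated (symPayoff g u w pen) (n + 1) c M) (x : X) :
    ∃ s ∈ S, ∀ m, Dominated (symPayoff g u w pen) n (fun i => c i - g i x ⬝ᵥ u m)
      (M - s ⬝ᵥ w m + pen m) := by
  set r := symPayoff g u w pen with hr
  -- A move bundled with the continuation and the selection that would exploit it; each bundle is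
  -- one affine constraint on the response.
  let I := E × Tree (X × E) n × ((Fin n → ℤˣ) → ι)
  let k : I → ℝ := fun j => continuationValue r (fun _ => 0) j.2.1 j.2.2
  let D : (ι → ℝ) → I → ℝ := fun c j => pathMean n fun ε => c (j.2.2 ε)
  suffices hmix : ∀ (v : Finset I) (q : I → ℝ), (∀ j, 0 ≤ q j) → ∑ j ∈ v, q j = 1 →
      ∃ s ∈ S, ∑ j ∈ v, q j * (s ⬝ᵥ w j.1 +
        (continuationValue r (fun i => c i - g i x ⬝ᵥ u j.1) j.2.1 j.2.2 - pen j.1 - M)) ≤ 0 by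
    obtain ⟨s, hs, hle⟩ := exists_forall_affine_nonpos hS hconv (fun j : I => w j.1) _ hmix hne
    refine ⟨s, hs, fun m z σ => ?_⟩
    have := hle (m, z, σ)
    dsimp only at this
    linarith
  intro v q hq hq1
  -- Against a known mixture the response minimizes the mean loss; comparators take values in `S`,
  -- so none does better on average.
  obtain ⟨s, hs, hmin⟩ := hS.exists_isMinOn hne
    (f := fun s : κ → ℝ => s ⬝ᵥ ∑ j ∈ v, q j • w j.1)
    (Continuous.continuousOn (by unfold dotProduct; fun_prop))
  refine ⟨s, hs, ?_⟩
  have hdot : ∀ s' : κ → ℝ, s' ⬝ᵥ ∑ j ∈ v, q j • w j.1 = ∑ j ∈ v, q j * s' ⬝ᵥ w j.1 := fun s' => by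
    rw [dotProduct_sum]
    simp [dotProduct_smul]
  have hmin' : ∀ i, ∑ j ∈ v, q j * s ⬝ᵥ w j.1 ≤ ∑ j ∈ v, q j * g i x ⬝ᵥ w j.1 := fun i => by
    rw [← hdot, ← hdot]
    exact hmin (hg i x)
  -- the pairwise terms
  let R : I → I → ℝ := fun j l => D c j - D (fun i => g i x ⬝ᵥ u j.1) j
    + D (fun i => g i x ⬝ᵥ w l.1) j + k j - pen j.1
  -- Glue the continuations of `j` (sign 1) and `l` (sign -1) below the root `l.1`, and the reverse
  -- below `j.1`. The two bounds add up to the claim.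
  have hpair : ∀ j l, R j l + R l j ≤ 2 * M := by
    intro j l
    have h1 : ∀ j l : I, (D c j + 2 * D (fun i => g i x ⬝ᵥ w l.1) j - pen l.1 + k j
        + (D c l - 2 * D (fun i => g i x ⬝ᵥ u l.1) l - pen l.1 + k l)) / 2 ≤ M := by
      intro j l
      refine le_of_eq_of_le ?_ (h.glue (x, l.1) j.2.1 l.2.1 j.2.2 l.2.2)
      rw [continuationValue_eq_add, continuationValue_eq_add r (fun i => c i + r (-1) i (x, l.1))]
      have e1 : ∀ ε, c (j.2.2 ε) + r 1 (j.2.2 ε) (x, l.1) = c (j.2.2 ε)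
          + 2 * (g (j.2.2 ε) x ⬝ᵥ w l.1) - pen l.1 := fun ε => by
        simp only [hr, symPayoff, Units.val_one, Int.cast_one]
        ring
      have e2 : ∀ ε, c (l.2.2 ε) + r (-1) (l.2.2 ε) (x, l.1) = c (l.2.2 ε)
          - 2 * (g (l.2.2 ε) x ⬝ᵥ u l.1) - pen l.1 := fun ε => by
        simp only [hr, symPayoff, Units.val_neg, Units.val_one, Int.cast_neg, Int.cast_one]
        ring
      simp only [e1, e2, pathMean_add, pathMean_sub, pathMean_mul, pathMean_const, D, k]
    have a1 := h1 j l
    have a2 := h1 l j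
    simp only [R]
    linarith
  -- The minimality holds for each comparator, hence for the one selected on each path.
  have hstep : ∀ j, ∑ l ∈ v, q l * s ⬝ᵥ w l.1 ≤ ∑ l ∈ v, q l * D (fun i => g i x ⬝ᵥ w l.1) j := by
    intro j
    have e : ∑ l ∈ v, q l * D (fun i => g i x ⬝ᵥ w l.1) j =
        pathMean n fun ε => ∑ l ∈ v, q l * g (j.2.2 ε) x ⬝ᵥ w l.1 := by
      rw [pathMean_sum]
      simp only [pathMean_mul, D]
    rw [e]
    calc _ = pathMean n fun _ => ∑ l ∈ v, q l * s ⬝ᵥ w l.1 := (pathMean_const n _).symm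
      _ ≤ _ := pathMean_mono n fun ε => hmin' _
  have hval : ∀ j : I, continuationValue r (fun i => c i - g i x ⬝ᵥ u j.1) j.2.1 j.2.2 =
      D c j - D (fun i => g i x ⬝ᵥ u j.1) j + k j := fun j => by
    rw [continuationValue_eq_add, pathMean_sub]
  have hone : ∀ b : ℝ, b = ∑ l ∈ v, q l * b := fun b => by rw [← Finset.sum_mul, hq1, one_mul]
  calc ∑ j ∈ v, q j * (s ⬝ᵥ w j.1 +
        (continuationValue r (fun i => c i - g i x ⬝ᵥ u j.1) j.2.1 j.2.2 - pen j.1 - M))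
      = ∑ j ∈ v, q j * (D c j - D (fun i => g i x ⬝ᵥ u j.1) j + k j - pen j.1
          + ∑ l ∈ v, q l * s ⬝ᵥ w l.1) - M := by
        simp only [hval, mul_add, mul_sub, Finset.sum_add_distrib, Finset.sum_sub_distrib,
          ← Finset.sum_mul, hq1, one_mul]
        ring
    _ ≤ ∑ j ∈ v, q j * (D c j - D (fun i => g i x ⬝ᵥ u j.1) j + k j - pen j.1
          + ∑ l ∈ v, q l * D (fun i => g i x ⬝ᵥ w l.1) j) - M := by
        exact sub_le_sub_right (Finset.sum_le_sum fun j _ =>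
          mul_le_mul_of_nonneg_left (add_le_add_right (hstep j) _) (hq j)) _
    _ = ∑ j ∈ v, ∑ l ∈ v, q j * q l * R j l - M := by
        congr 1
        refine Finset.sum_congr rfl fun j _ => ?_
        rw [hone (D c j - D (fun i => g i x ⬝ᵥ u j.1) j + k j - pen j.1),
          ← Finset.sum_add_distrib, Finset.mul_sum]
        refine Finset.sum_congr rfl fun l _ => ?_
        simp only [R]
        ring
    -- `j` and `l` act as independent draws from one mixture and may be exchanged.
    _ = (∑ j ∈ v, ∑ l ∈ v, q j * q l * (R j l + R l j)) / 2 - M := by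
        have : ∑ j ∈ v, ∑ l ∈ v, q j * q l * R l j = ∑ j ∈ v, ∑ l ∈ v, q j * q l * R j l := by
          rw [Finset.sum_comm]
          exact Finset.sum_congr rfl fun j _ => Finset.sum_congr rfl fun l _ => by ring
        simp only [mul_add, Finset.sum_add_distrib, this]
        ring
    _ ≤ (∑ j ∈ v, ∑ l ∈ v, q j * q l * (2 * M)) / 2 - M := by
        gcongr with j _ l _
        · exact mul_nonneg (hq j) (hq l)
        · exact hpair j l
    _ = 0 := by
        simp only [mul_assoc, ← Finset.mul_sum, ← Finset.sum_mul, hq1]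
        ring

end Game

/-! ### The law of the actions -/

theorem actionLaw_snoc {X : Type*} {K : ℕ} (S : Strategy X K) (A : Adversary X K) (t : ℕ)
    (a : Fin t → Fin K) (b : Fin K) :
    actionLaw S A (t + 1) (Fin.snoc (α := fun _ => Fin K) a b) =
      actionLaw S A t a * S t (A.feedback a) (A.context t a) b := by
  have hsnoc : ∀ (a' : Fin t → Fin K) (b' : Fin K),
      (Fin.snoc (α := fun _ => Fin K) a b = Fin.snoc (α := fun _ => Fin K) a' b') ↔
        a = a' ∧ b = b' := fun a' b' => Fin.snoc_inj
  rw [actionLaw, PMF.bind_apply, tsum_fintype, Finset.sum_eq_single a]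
  · rw [PMF.map_apply, tsum_fintype, Finset.sum_eq_single b]
    · simp
    · intro b' _ hb'
      simp [hsnoc, hb'.symm]
    · simp
  · intro a' _ ha'
    rw [PMF.map_apply, tsum_fintype, Finset.sum_eq_zero, mul_zero]
    intro b' _
    simp [hsnoc, ha'.symm]
  · simp

theorem sum_actionLaw_succ {X : Type*} {K : ℕ} (S : Strategy X K) (A : Adversary X K) (t : ℕ)
    (Φ : (Fin (t + 1) → Fin K) → ℝ) :
    ∑ a, (actionLaw S A (t + 1) a).toReal * Φ a = ∑ a : Fin t → Fin K,
      (actionLaw S A t a).toReal * ∑ b, (S t (A.feedback a) (A.context t a) b).toReal *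
        Φ (Fin.snoc (α := fun _ => Fin K) a b) := by
  rw [← (Fin.snocEquiv fun _ : Fin (t + 1) => Fin K).sum_comp, Fintype.sum_prod_type_right]
  refine Finset.sum_congr rfl fun a _ => ?_
  rw [Finset.mul_sum]
  refine Finset.sum_congr rfl fun b _ => ?_
  have : (Fin.snocEquiv fun _ : Fin (t + 1) => Fin K) (b, a) =
    Fin.snoc (α := fun _ => Fin K) a b := rfl
  simp only [this, actionLaw_snoc, ENNReal.toReal_mul, mul_assoc]

theorem sum_toReal_pmf {κ : Type*} [Fintype κ] (p : PMF κ) : ∑ a, (p a).toReal = 1 := by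
  rw [← ENNReal.toReal_sum fun a _ => p.apply_ne_top a, ← tsum_fintype (L := .unconditional _),
    p.tsum_coe, ENNReal.toReal_one]

section Snoc

variable {X : Type*} {K t : ℕ} (A : Adversary X K) (a : Fin t → Fin K) (b : Fin K)

theorem before_snoc_castSucc (s : Fin t) :
    before (Fin.snoc (α := fun _ => Fin K) a b : Fin (t + 1) → Fin K) s.castSucc = before a s := by
  funext i
  exact Fin.snoc_castSucc (α := fun _ => Fin K) b a (Fin.castLE s.isLt.le i)

theorem before_snoc_last :
    before (Fin.snoc (α := fun _ => Fin K) a b : Fin (t + 1) → Fin K) (Fin.last t) = a := by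
  funext i
  exact Fin.snoc_castSucc (α := fun _ => Fin K) b a i

theorem Adversary.sum_rounds_snoc (Ψ : X → (Fin K → ℝ) → Fin K → ℝ) :
    ∑ s, Ψ (A.contextAt (Fin.snoc (α := fun _ => Fin K) a b) s)
        (A.lossAt (Fin.snoc (α := fun _ => Fin K) a b) s)
        ((Fin.snoc (α := fun _ => Fin K) a b : Fin (t + 1) → Fin K) s) =
      ∑ s, Ψ (A.contextAt a s) (A.lossAt a s) (a s) + Ψ (A.context t a) (A.loss t a) b := by
  rw [Fin.sum_univ_castSucc]
  have h1 : ∀ s : Fin t, A.contextAt (Fin.snoc (α := fun _ => Fin K) a b) s.castSucc =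
      A.contextAt a s := fun s => congrArg (A.context s) (before_snoc_castSucc a b s)
  have h2 : ∀ s : Fin t, A.lossAt (Fin.snoc (α := fun _ => Fin K) a b) s.castSucc =
      A.lossAt a s := fun s => congrArg (A.loss s) (before_snoc_castSucc a b s)
  have h3 : A.contextAt (Fin.snoc (α := fun _ => Fin K) a b) (Fin.last t) = A.context t a :=
    congrArg (A.context t) (before_snoc_last a b)
  have h4 : A.lossAt (Fin.snoc (α := fun _ => Fin K) a b) (Fin.last t) = A.loss t a :=
    congrArg (A.loss t) (before_snoc_last a b)
  simp only [h1, h2, h3, h4, Fin.snoc_castSucc, Fin.snoc_last]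

theorem Adversary.init_feedback_snoc :
    (Fin.init (A.feedback (Fin.snoc (α := fun _ => Fin K) a b)) : Fin t → X × Fin K × ℝ) =
      A.feedback a := by
  funext s
  have h1 : A.contextAt (Fin.snoc (α := fun _ => Fin K) a b) s.castSucc =
      A.contextAt a s := congrArg (A.context s) (before_snoc_castSucc a b s)
  have h2 : A.lossAt (Fin.snoc (α := fun _ => Fin K) a b) s.castSucc =
      A.lossAt a s := congrArg (A.loss s) (before_snoc_castSucc a b s)
  simp only [Fin.init, Adversary.feedback, h1, h2, Fin.snoc_castSucc]

theorem Adversary.feedback_snoc_last :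
    A.feedback (Fin.snoc (α := fun _ => Fin K) a b) (Fin.last t) =
      (A.context t a, b, A.loss t a b) := by
  have h3 : A.contextAt (Fin.snoc (α := fun _ => Fin K) a b) (Fin.last t) = A.context t a :=
    congrArg (A.context t) (before_snoc_last a b)
  have h4 : A.lossAt (Fin.snoc (α := fun _ => Fin K) a b) (Fin.last t) = A.loss t a :=
    congrArg (A.loss t) (before_snoc_last a b)
  simp only [Adversary.feedback, h3, h4, Fin.snoc_last]

end Snoc

/-! ### Weights and their normalization with uniform exploration -/

/-- Weight vectors in `[0,1]^K` of total mass at least one. -/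
def weightSet (K : ℕ) : Set (Fin K → ℝ) :=
  Set.Icc 0 1 ∩ {s | 1 ≤ ∑ a, s a}

theorem isCompact_weightSet (K : ℕ) : IsCompact (weightSet K) :=
  isCompact_Icc.inter_right (isClosed_le continuous_const (by fun_prop))

theorem convex_weightSet (K : ℕ) : Convex ℝ (weightSet K) := by
  refine (convex_Icc 0 1).inter ?_
  intro s hs s' hs' p p' hp hp' hpp
  simp only [Set.mem_ofPred_eq, Pi.add_apply, Pi.smul_apply, smul_eq_mul,
    Finset.sum_add_distrib, ← Finset.mul_sum] at hs hs' ⊢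
  nlinarith

theorem one_mem_weightSet {K : ℕ} (hK : 1 ≤ K) : (1 : Fin K → ℝ) ∈ weightSet K := by
  refine ⟨⟨zero_le_one, le_rfl⟩, ?_⟩
  simpa using hK

/-- The normalization of `s`, mixed with the uniform distribution so that every action has
probability at least `μ`. -/
noncomputable def exploring {K : ℕ} (μ : ℝ) (s : Fin K → ℝ) (a : Fin K) : ℝ :=
  (1 - K * μ) * (s a / ∑ b, s b) + μ

section Exploring

variable {K : ℕ} {μ : ℝ} {s : Fin K → ℝ}

theorem sum_exploring (hs : s ∈ weightSet K) : ∑ a, exploring μ s a = 1 := by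
  have h : 1 ≤ ∑ a, s a := hs.2
  unfold exploring
  rw [Finset.sum_add_distrib, ← Finset.mul_sum, ← Finset.sum_div, div_self (by linarith)]
  simp

theorem le_exploring (hKμ : K * μ ≤ 1) (hs : s ∈ weightSet K) (a : Fin K) :
    μ ≤ exploring μ s a := by
  have h : 1 ≤ ∑ a, s a := hs.2
  have h2 : 0 ≤ s a := hs.1.1 a
  have : 0 ≤ (1 - K * μ) * (s a / ∑ b, s b) :=
    mul_nonneg (by linarith) (div_nonneg h2 (by linarith))
  unfold exploring
  linarith

theorem exploring_le (hμ : 0 < μ) (hKμ : K * μ ≤ 1) (hs : s ∈ weightSet K) (a : Fin K) :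
    exploring μ s a ≤ s a + μ := by
  have h : 1 ≤ ∑ a, s a := hs.2
  have h2 : 0 ≤ s a := hs.1.1 a
  have h3 : s a / ∑ b, s b ≤ s a := div_le_self h2 h
  have h4 : 0 ≤ s a / ∑ b, s b := div_nonneg h2 (by linarith)
  have h5 : 0 ≤ K * μ := by positivity
  unfold exploring
  nlinarith

/-- For `K * μ ≤ 1/2` the normalized part suffices, as the total mass is at most `K`; otherwise
exploration alone gives probability at least `1/(2K)`. -/
theorem div_exploring_le (hμ : 0 < μ) (hKμ : K * μ ≤ 1) (hs : s ∈ weightSet K) (a : Fin K) :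
    s a / exploring μ s a ≤ 2 * K := by
  have h : 1 ≤ ∑ a, s a := hs.2
  have h2 : 0 ≤ s a := hs.1.1 a
  have h2' : s a ≤ 1 := hs.1.2 a
  have hpos : 0 < exploring μ s a := hμ.trans_le (le_exploring hKμ hs a)
  have hsum : ∑ a, s a ≤ K := by
    calc ∑ a, s a ≤ ∑ _a : Fin K, (1 : ℝ) := Finset.sum_le_sum fun a _ => hs.1.2 a
      _ = K := by simp
  have hK : (1 : ℝ) ≤ K := h.trans hsum
  rw [div_le_iff₀ hpos]
  rcases le_total (K * μ) (1 / 2) with hc | hc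
  · have h3 : s a / K ≤ s a / ∑ b, s b := div_le_div_of_nonneg_left h2 (by linarith) hsum
    have h4 : 1 / 2 * (s a / K) ≤ exploring μ s a := by
      have : 0 ≤ s a / K := by positivity
      unfold exploring
      nlinarith
    calc s a = 2 * K * (1 / 2 * (s a / K)) := by field_simp
      _ ≤ _ := by gcongr
  · calc s a ≤ 2 * (K * μ) := by linarith
      _ = 2 * K * μ := by ring
      _ ≤ _ := by
        gcongr
        exact le_exploring hKμ hs a

/-- The distribution with the probabilities `exploring μ s`. -/
noncomputable def exploringPMF (hμ : 0 < μ) (hKμ : K * μ ≤ 1) (s : weightSet K) : PMF (Fin K) :=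
  PMF.ofFintype (fun a => ENNReal.ofReal (exploring μ s a)) (by
    rw [← ENNReal.ofReal_sum_of_nonneg fun a _ => hμ.le.trans (le_exploring hKμ s.2 a),
      sum_exploring s.2, ENNReal.ofReal_one])

theorem toReal_exploringPMF (hμ : 0 < μ) (hKμ : K * μ ≤ 1) (s : weightSet K) (a : Fin K) :
    (exploringPMF hμ hKμ s a).toReal = exploring μ s a := by
  rw [exploringPMF, PMF.ofFintype_apply,
    ENNReal.toReal_ofReal (hμ.le.trans (le_exploring hKμ s.2 a))]

end Exploring

/-! ### The strategy -/

/-- A loss estimate: an action and its importance-weighted loss. -/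
abbrev Estimate (K : ℕ) (μ : ℝ) : Type := Fin K × Set.Icc (0 : ℝ) (1 / μ)

/-- The loss vector of an estimate. -/
def Estimate.vec {K : ℕ} {μ : ℝ} (m : Estimate K μ) : Fin K → ℝ := Pi.single m.1 (m.2 : ℝ)

/-- The loss vector of an estimate, reduced by a multiple of its square. -/
def Estimate.vecSub {K : ℕ} {μ : ℝ} (η : ℝ) (m : Estimate K μ) : Fin K → ℝ :=
  Pi.single m.1 ((m.2 : ℝ) - η * (m.2 : ℝ) ^ 2)

/-- The part of the penalty of an estimate that does not depend on the comparator. -/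
def Estimate.pen {K : ℕ} {μ : ℝ} (lam ζ : ℝ) (m : Estimate K μ) : ℝ :=
  lam * (m.2 : ℝ) ^ 2 + ζ * (m.2 : ℝ)

section Strategy

variable {X ι : Type*} {K : ℕ} {μ : ℝ}

/-- The symmetrized payoff of the game on loss estimates. -/
def banditPayoff (μ : ℝ) (g : ι → X → Fin K → ℝ) (η lam ζ : ℝ) :
    ℤˣ → ι → X × Estimate K μ → ℝ :=
  symPayoff g Estimate.vec (Estimate.vecSub η) (Estimate.pen lam ζ)

/-- Responses become a total function of the state, with the all-ones vector as default where the
invariant fails, so that the strategy can be defined before the invariant is proved. -/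
theorem exists_responseRule (μ : ℝ) (hK : 1 ≤ K) {g : ι → X → Fin K → ℝ}
    (hg : ∀ i x, g i x ∈ weightSet K) (η lam ζ : ℝ) :
    ∃ resp : ℕ → (ι → ℝ) → ℝ → X → weightSet K, ∀ n c M x,
      Dominated (banditPayoff μ g η lam ζ) (n + 1) c M → ∀ m : Estimate K μ,
        Dominated (banditPayoff μ g η lam ζ) n (fun i => c i - g i x ⬝ᵥ m.vec)
          (M - (resp n c M x : Fin K → ℝ) ⬝ᵥ m.vecSub η + m.pen lam ζ) := by
  have h : ∀ (n : ℕ) (c : ι → ℝ) (M : ℝ) (x : X), ∃ s : weightSet K,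
      Dominated (banditPayoff μ g η lam ζ) (n + 1) c M → ∀ m : Estimate K μ,
        Dominated (banditPayoff μ g η lam ζ) n (fun i => c i - g i x ⬝ᵥ m.vec)
          (M - (s : Fin K → ℝ) ⬝ᵥ m.vecSub η + m.pen lam ζ) := by
    intro n c M x
    by_cases hd : Dominated (banditPayoff μ g η lam ζ) (n + 1) c M
    · obtain ⟨s, hs, h⟩ := hd.exists_response (isCompact_weightSet K) (convex_weightSet K)
        ⟨1, one_mem_weightSet hK⟩ hg x
      exact ⟨⟨s, hs⟩, fun _ => h⟩
    · exact ⟨⟨1, one_mem_weightSet hK⟩, fun h => absurd h hd⟩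
  choose resp hresp using h
  exact ⟨resp, hresp⟩

/-- The importance-weighted estimate computed from an action and its loss. -/
noncomputable def estimate (hμ : 0 < μ) (s : Fin K → ℝ) (a : Fin K) (y : ℝ) : Estimate K μ :=
  (a, Set.projIcc 0 (1 / μ) (by positivity) (y / exploring μ s a))

/-- The projection in `estimate` only makes it total: probabilities are at least `μ`, so it is
inactive on losses in `[0,1]`. -/
theorem coe_estimate (hμ : 0 < μ) (hKμ : K * μ ≤ 1) {s : Fin K → ℝ} (hs : s ∈ weightSet K)
    (a : Fin K) {y : ℝ} (hy : y ∈ Set.Icc (0 : ℝ) 1) :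
    ((estimate hμ s a y).2 : ℝ) = y / exploring μ s a := by
  have h := le_exploring hKμ hs a
  have h2 : y / exploring μ s a ∈ Set.Icc 0 (1 / μ) :=
    ⟨div_nonneg hy.1 (hμ.le.trans h), div_le_div₀ zero_le_one hy.2 hμ h⟩
  unfold estimate
  rw [Set.projIcc_of_mem _ h2]

variable (hμ : 0 < μ) (hKμ : K * μ ≤ 1) (g : ι → X → Fin K → ℝ) (η lam ζ : ℝ)
  (resp : ℕ → (ι → ℝ) → ℝ → X → weightSet K)

/-- One round of bookkeeping, with `n` further rounds to come: the accumulated comparator payoffs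
and the remaining budget. -/
noncomputable def updateState (n : ℕ) (st : (ι → ℝ) × ℝ) (o : X × Fin K × ℝ) : (ι → ℝ) × ℝ :=
  let s := resp n st.1 st.2 o.1
  let m := estimate hμ s o.2.1 o.2.2
  (fun i => st.1 i - g i o.1 ⬝ᵥ m.vec, st.2 - (s : Fin K → ℝ) ⬝ᵥ m.vecSub η + m.pen lam ζ)

/-- The state of the learner after the history `h`, in a game of `T` rounds with budget `M₀`. -/
noncomputable def learnerState (T : ℕ) (M₀ : ℝ) :
    (t : ℕ) → (Fin t → X × Fin K × ℝ) → (ι → ℝ) × ℝ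
  | 0, _ => (fun _ => 0, M₀)
  | t + 1, h => updateState hμ g η lam ζ resp (T - t - 1) (learnerState T M₀ t (Fin.init h))
      (h (Fin.last t))

/-- The strategy that plays the normalized responses with exploration. -/
noncomputable def learner (T : ℕ) (M₀ : ℝ) : Strategy X K := fun t h x =>
  exploringPMF hμ hKμ (resp (T - t - 1) (learnerState hμ g η lam ζ resp T M₀ t h).1
    (learnerState hμ g η lam ζ resp T M₀ t h).2 x)

variable {g η lam ζ resp}

/-- No adversary is involved: any history whatsoever yields estimates in the allowed range, and the
response rule covers all of those. -/
theorem dominated_learnerState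
    (hresp : ∀ n c M x, Dominated (banditPayoff μ g η lam ζ) (n + 1) c M → ∀ m : Estimate K μ,
        Dominated (banditPayoff μ g η lam ζ) n (fun i => c i - g i x ⬝ᵥ m.vec)
          (M - (resp n c M x : Fin K → ℝ) ⬝ᵥ m.vecSub η + m.pen lam ζ))
    {T : ℕ} {M₀ : ℝ} (h₀ : Dominated (banditPayoff μ g η lam ζ) T (fun _ => 0) M₀) :
    ∀ (t : ℕ), t ≤ T → ∀ h : Fin t → X × Fin K × ℝ,
      Dominated (banditPayoff μ g η lam ζ) (T - t) (learnerState hμ g η lam ζ resp T M₀ t h).1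
        (learnerState hμ g η lam ζ resp T M₀ t h).2 := by
  intro t
  induction t with
  | zero => exact fun _ _ => h₀
  | succ t ih =>
    intro ht h
    have h1 := ih (by omega) (Fin.init h)
    rw [show T - t = (T - t - 1) + 1 by omega] at h1
    exact hresp _ _ _ (h (Fin.last t)).1 h1 _

/-- After multiplication by the probability `p` of the action, the summand is `(p - s)l + η(s/p)l² +
λl²/p + ζl`, whose terms are at most `μ`, `2ηK`, `λ/μ` and `ζ`. -/
theorem round_cost_le (hKμ : K * μ ≤ 1) (hη : 0 ≤ η) (hlam : 0 ≤ lam) (hζ : 0 ≤ ζ) {s : Fin K → ℝ}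
    (hs : s ∈ weightSet K) {l : Fin K → ℝ} (hl : ∀ a, l a ∈ Set.Icc (0 : ℝ) 1) :
    ∑ a, exploring μ s a * (l a - s ⬝ᵥ (estimate hμ s a (l a)).vecSub η +
        (estimate hμ s a (l a)).pen lam ζ) ≤ K * (μ + 2 * η * K + lam / μ + ζ) := by
  have h : ∀ a, exploring μ s a * (l a - s ⬝ᵥ (estimate hμ s a (l a)).vecSub η +
        (estimate hμ s a (l a)).pen lam ζ) ≤ μ + 2 * η * K + lam / μ + ζ := by
    intro a
    have hle := le_exploring hKμ hs a
    have hup := exploring_le hμ hKμ hs a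
    have hdiv := div_exploring_le hμ hKμ hs a
    have hpos : 0 < exploring μ s a := hμ.trans_le hle
    obtain ⟨hl0, hl1⟩ := hl a
    have hs0 : 0 ≤ s a := hs.1.1 a
    have h1 : (estimate hμ s a (l a)).1 = a := rfl
    unfold Estimate.vecSub Estimate.pen
    rw [dotProduct_single, h1, coe_estimate hμ hKμ hs a (hl a)]
    set p := exploring μ s a
    have e : p * (l a - s a * (l a / p - η * (l a / p) ^ 2) + (lam * (l a / p) ^ 2 + ζ * (l a / p)))
        = (p - s a) * l a + η * (s a / p) * l a ^ 2 + lam * (l a ^ 2 / p) + ζ * l a := by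
      field_simp
      ring
    rw [e]
    have hsq : l a ^ 2 ≤ 1 := pow_le_one₀ hl0 hl1
    have hsp : 0 ≤ s a / p := div_nonneg hs0 hpos.le
    have t1 : (p - s a) * l a ≤ μ := by nlinarith
    have t2 : η * (s a / p) * l a ^ 2 ≤ 2 * η * K :=
      calc η * (s a / p) * l a ^ 2 ≤ η * (s a / p) * 1 := by gcongr
        _ ≤ η * (2 * K) * 1 := by gcongr
        _ = _ := by ring
    have t3 : lam * (l a ^ 2 / p) ≤ lam / μ := by
      rw [div_eq_mul_one_div lam]
      gcongr
    have t4 : ζ * l a ≤ ζ := mul_le_of_le_one_right hζ hl1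
    linarith
  calc _ ≤ ∑ _a : Fin K, (μ + 2 * η * K + lam / μ + ζ) := Finset.sum_le_sum fun a _ => h a
    _ = _ := by
      rw [Finset.sum_const, Finset.card_univ, Fintype.card_fin, nsmul_eq_mul]

theorem sum_exploring_mul_estimate (hKμ : K * μ ≤ 1) (g' : Fin K → ℝ) {s : Fin K → ℝ} (hs : s ∈ weightSet K)
    {l : Fin K → ℝ} (hl : ∀ a, l a ∈ Set.Icc (0 : ℝ) 1) :
    ∑ a, exploring μ s a * g' ⬝ᵥ (estimate hμ s a (l a)).vec = ∑ a, l a * g' a := by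
  refine Finset.sum_congr rfl fun a _ => ?_
  have hpos : 0 < exploring μ s a := hμ.trans_le (le_exploring hKμ hs a)
  unfold Estimate.vec
  rw [dotProduct_single, coe_estimate hμ hKμ hs a (hl a)]
  change _ * (g' a * _) = _
  field_simp

/-- The potential is the regret so far plus the budget minus the comparator payoff. The comparator's
estimated loss is unbiased and cancels in the mean, so a round adds at most the cost in
`round_cost_le`. -/
theorem learner_potential_le (hη : 0 ≤ η) (hlam : 0 ≤ lam) (hζ : 0 ≤ ζ) (T : ℕ) (M₀ : ℝ)
    (A : Adversary X K) (i : ι) (t : ℕ) :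
    ∑ a : Fin t → Fin K, (actionLaw (learner hμ hKμ g η lam ζ resp T M₀) A t a).toReal *
      (∑ s, (A.lossAt a s (a s) - ∑ b, A.lossAt a s b * g i (A.contextAt a s) b) +
        (learnerState hμ g η lam ζ resp T M₀ t (A.feedback a)).2 -
        (learnerState hμ g η lam ζ resp T M₀ t (A.feedback a)).1 i) ≤
      M₀ + t * (K * (μ + 2 * η * K + lam / μ + ζ)) := by
  induction t with
  | zero =>
    have := sum_toReal_pmf (actionLaw (learner hμ hKμ g η lam ζ resp T M₀) A 0)
    simp only [learnerState, Finset.univ_eq_empty, Finset.sum_empty, zero_add, sub_zero,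
      ← Finset.sum_mul, this]
    simp
  | succ t ih =>
    set S := learner hμ hKμ g η lam ζ resp T M₀ with hS
    set B := K * (μ + 2 * η * K + lam / μ + ζ) with hB
    rw [sum_actionLaw_succ]
    have hstep : ∀ a : Fin t → Fin K, ∑ b, (S t (A.feedback a) (A.context t a) b).toReal *
        (∑ s, (A.lossAt (Fin.snoc (α := fun _ => Fin K) a b) s
            ((Fin.snoc (α := fun _ => Fin K) a b : Fin (t + 1) → Fin K) s) -
            ∑ b', A.lossAt (Fin.snoc (α := fun _ => Fin K) a b) s b' *
              g i (A.contextAt (Fin.snoc (α := fun _ => Fin K) a b) s) b') +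
          (learnerState hμ g η lam ζ resp T M₀ (t + 1)
            (A.feedback (Fin.snoc (α := fun _ => Fin K) a b))).2 -
          (learnerState hμ g η lam ζ resp T M₀ (t + 1)
            (A.feedback (Fin.snoc (α := fun _ => Fin K) a b))).1 i) ≤
        (∑ s, (A.lossAt a s (a s) - ∑ b, A.lossAt a s b * g i (A.contextAt a s) b) +
        (learnerState hμ g η lam ζ resp T M₀ t (A.feedback a)).2 -
        (learnerState hμ g η lam ζ resp T M₀ t (A.feedback a)).1 i) + B := by
      intro a
      set st := learnerState hμ g η lam ζ resp T M₀ t (A.feedback a) with hst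
      set x := A.context t a
      set l := A.loss t a with hldef
      have hl : ∀ b, l b ∈ Set.Icc (0 : ℝ) 1 := A.loss_mem t a
      set w := resp (T - t - 1) st.1 st.2 x with hw
      have hprob : ∀ b, (S t (A.feedback a) x b).toReal = exploring μ w b := fun b => by
        rw [hS, learner, toReal_exploringPMF]
      have hstate : ∀ b, learnerState hμ g η lam ζ resp T M₀ (t + 1)
            (A.feedback (Fin.snoc (α := fun _ => Fin K) a b)) =
          (fun i => st.1 i - g i x ⬝ᵥ (estimate hμ w b (l b)).vec,
            st.2 - (w : Fin K → ℝ) ⬝ᵥ (estimate hμ w b (l b)).vecSub η +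
              (estimate hμ w b (l b)).pen lam ζ) := fun b => by
        rw [learnerState, A.init_feedback_snoc, A.feedback_snoc_last, ← hst]
        rfl
      have hsum := fun b => A.sum_rounds_snoc a b
        (fun x l b => l b - ∑ b', l b' * g i x b')
      simp only [hprob, hstate, hsum]
      have h1 := round_cost_le hμ hKμ hη hlam hζ w.2 hl
      have h2 := sum_exploring_mul_estimate hμ hKμ (g i x) w.2 hl
      have h3 := sum_exploring (μ := μ) w.2
      set Q := ∑ s, (A.lossAt a s (a s) - ∑ b, A.lossAt a s b * g i (A.contextAt a s) b)
      set D := ∑ b', l b' * g i x b'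
      calc _ = ∑ b, exploring μ (w : Fin K → ℝ) b * (Q + st.2 - st.1 i - D) +
            ∑ b, exploring μ (w : Fin K → ℝ) b * (l b - (w : Fin K → ℝ) ⬝ᵥ (estimate hμ w b (l b)).vecSub η +
              (estimate hμ w b (l b)).pen lam ζ) +
            ∑ b, exploring μ (w : Fin K → ℝ) b * g i x ⬝ᵥ (estimate hμ w b (l b)).vec := by
            rw [← Finset.sum_add_distrib, ← Finset.sum_add_distrib]
            refine Finset.sum_congr rfl fun b _ => ?_
            rw [hldef]
            ring
        _ ≤ _ := by
            rw [h2, ← Finset.sum_mul, h3]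
            linarith
    calc _ ≤ ∑ a : Fin t → Fin K, (actionLaw S A t a).toReal *
        ((∑ s, (A.lossAt a s (a s) - ∑ b, A.lossAt a s b * g i (A.contextAt a s) b) +
        (learnerState hμ g η lam ζ resp T M₀ t (A.feedback a)).2 -
        (learnerState hμ g η lam ζ resp T M₀ t (A.feedback a)).1 i) + B) :=
          Finset.sum_le_sum fun a _ => mul_le_mul_of_nonneg_left (hstep a) ENNReal.toReal_nonneg
      _ ≤ _ := by
          simp only [mul_add _ _ B]
          rw [Finset.sum_add_distrib, ← Finset.sum_mul, sum_toReal_pmf]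
          push_cast
          linarith

end Strategy

/-- A bound on the value of the symmetrized game gives a bandit strategy with the corresponding
regret against the comparators `g`. -/
theorem exists_strategy_of_dominated {X ι : Type*} {K : ℕ} {μ : ℝ} (hK : 1 ≤ K) (hμ : 0 < μ)
    (hKμ : K * μ ≤ 1) {g : ι → X → Fin K → ℝ} (hg : ∀ i x, g i x ∈ weightSet K)
    {η lam ζ : ℝ} (hη : 0 ≤ η) (hlam : 0 ≤ lam) (hζ : 0 ≤ ζ) {T : ℕ} {M₀ : ℝ}
    (h₀ : Dominated (banditPayoff μ g η lam ζ) T (fun _ => 0) M₀) :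
    ∃ S : Strategy X K, ∀ (A : Adversary X K) (i : ι),
      ∑ a : Fin T → Fin K, (actionLaw S A T a).toReal * A.cumLoss a ≤
        ∑ a : Fin T → Fin K, (actionLaw S A T a).toReal *
          ∑ s, ∑ b, A.lossAt a s b * g i (A.contextAt a s) b +
        (M₀ + T * (K * (μ + 2 * η * K + lam / μ + ζ))) := by
  obtain ⟨resp, hresp⟩ := exists_responseRule μ hK hg η lam ζ
  refine ⟨learner hμ hKμ g η lam ζ resp T M₀, fun A i => ?_⟩
  have h1 := learner_potential_le hμ hKμ (g := g) (resp := resp) hη hlam hζ T M₀ A i T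
  rw [← sub_le_iff_le_add', ← Finset.sum_sub_distrib]
  refine le_trans (Finset.sum_le_sum fun a _ => ?_) h1
  rw [← mul_sub]
  refine mul_le_mul_of_nonneg_left ?_ ENNReal.toReal_nonneg
  have h2 := dominated_learnerState hμ hresp h₀ T le_rfl (A.feedback a)
  rw [Nat.sub_self] at h2
  have h3 := dominated_zero h2 i
  rw [Adversary.cumLoss, Finset.sum_sub_distrib]
  linarith

/-! ### Chaining -/

theorem cosh_mul_exp_neg_le_one {a b : ℝ} (h : a ^ 2 / 2 ≤ b) :
    (Real.exp (a - b) + Real.exp (-a - b)) / 2 ≤ 1 := by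
  have h1 := Real.cosh_le_exp_half_sq a
  have h2 : (Real.exp (a - b) + Real.exp (-a - b)) / 2 = Real.cosh a * Real.exp (-b) := by
    rw [Real.cosh_eq, sub_eq_add_neg, sub_eq_add_neg, Real.exp_add, Real.exp_add]
    ring
  rw [h2]
  calc Real.cosh a * Real.exp (-b) ≤ Real.exp b * Real.exp (-b) := by
        gcongr
        exact h1.trans (Real.exp_le_exp.2 h)
    _ = 1 := by rw [← Real.exp_add, add_neg_cancel, Real.exp_zero]

/-- The exponential supermartingale inequality for a predictable process on random signs. -/
theorem pathMean_exp_le_one {n : ℕ} (a b : Tree ℝ n) (h : ∀ t p, a t p ^ 2 / 2 ≤ b t p) :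
    pathMean n (fun ε => Real.exp (∑ t, (((ε t : ℤˣ) : ℤ) * a.value ε t - b.value ε t))) ≤ 1 := by
  induction n with
  | zero => simp [pathMean_zero]
  | succ n ih =>
    have hchild : ∀ e : ℤˣ, pathMean n (fun ε => Real.exp
        (∑ t, (((ε t : ℤˣ) : ℤ) * (a.child e).value ε t - (b.child e).value ε t))) ≤ 1 :=
      fun e => ih _ _ fun t p => h _ _
    set ε₀ : Fin (n + 1) → ℤˣ := fun _ => 1
    have hsplit : ∀ e : ℤˣ, (fun ε : Fin n → ℤˣ => Real.exp (∑ t,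
        (((((Fin.cons e ε : Fin (n + 1) → ℤˣ) t : ℤˣ) : ℤ) : ℝ) *
          a.value (Fin.cons e ε : Fin (n + 1) → ℤˣ) t -
          b.value (Fin.cons e ε : Fin (n + 1) → ℤˣ) t))) = fun ε =>
        Real.exp (((e : ℤ) : ℝ) * a.value ε₀ 0 - b.value ε₀ 0) * Real.exp
          (∑ t, (((ε t : ℤˣ) : ℤ) * (a.child e).value ε t - (b.child e).value ε t)) := by
      intro e
      funext ε
      rw [Fin.sum_univ_succ, Real.exp_add]
      simp only [Fin.cons_zero, Fin.cons_succ, Tree.value_succ_cons,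
        Tree.value_zero_cons _ e ε ε₀]
    rw [pathMean_succ, hsplit, hsplit, pathMean_mul, pathMean_mul]
    refine le_trans ?_ (cosh_mul_exp_neg_le_one (h 0 fun i => ε₀ (Fin.castLE (0 : Fin (n + 1)).isLt.le i)))
    have e1 : (((1 : ℤˣ) : ℤ) : ℝ) * a.value ε₀ 0 = a.value ε₀ 0 := by simp
    have e2 : (((-1 : ℤˣ) : ℤ) : ℝ) * a.value ε₀ 0 = -a.value ε₀ 0 := by simp
    rw [e1, e2]
    gcongr
    · exact mul_le_of_le_one_right (Real.exp_pos _).le (hchild 1)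
    · exact mul_le_of_le_one_right (Real.exp_pos _).le (hchild (-1))

/-- The maximal inequality for finitely many predictable processes with quadratic offsets. -/
theorem pathMean_select_le {κ : Type*} {n : ℕ} (W : Finset κ) (a b : κ → Tree ℝ n) {τ : ℝ}
    (hτ : 0 < τ) (h : ∀ k ∈ W, ∀ t p, τ * a k t p ^ 2 / 2 ≤ b k t p)
    (w : (Fin n → ℤˣ) → κ) (hw : ∀ ε, w ε ∈ W) :
    pathMean n (fun ε => ∑ t, (((ε t : ℤˣ) : ℤ) * (a (w ε)).value ε t - (b (w ε)).value ε t)) ≤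
      1 / τ * Real.log W.card := by
  have hN : (0 : ℝ) < W.card := by
    exact_mod_cast Finset.card_pos.2 ⟨w fun _ => 1, hw _⟩
  set Z : κ → (Fin n → ℤˣ) → ℝ := fun k ε =>
    ∑ t, (((ε t : ℤˣ) : ℤ) * (a k).value ε t - (b k).value ε t)
  have hexp : ∀ k ∈ W, pathMean n (fun ε => Real.exp (τ * Z k ε)) ≤ 1 := by
    intro k hk
    refine le_of_eq_of_le ?_ (pathMean_exp_le_one ((a k).map (τ * ·)) ((b k).map (τ * ·))
      fun t p => ?_)
    · congr 1
      funext ε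
      rw [Finset.mul_sum]
      congr 1
      refine Finset.sum_congr rfl fun t _ => ?_
      rw [Tree.value_map, Tree.value_map]
      ring
    · have := mul_le_mul_of_nonneg_left (h k hk t p) hτ.le
      simp only [Tree.map]
      linarith
  -- The inequality `log x ≤ x - 1` at `x = exp (τ Z) / |W|`, applied pathwise, takes the place of
  -- Jensen's inequality.
  have hpt : ∀ ε, τ * Z (w ε) ε ≤ Real.log W.card +
      ((1 / (W.card : ℝ)) * ∑ k ∈ W, Real.exp (τ * Z k ε) - 1) := by
    intro ε
    have h1 : Real.exp (τ * Z (w ε) ε) ≤ ∑ k ∈ W, Real.exp (τ * Z k ε) :=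
      Finset.single_le_sum (f := fun k => Real.exp (τ * Z k ε))
        (fun k _ => (Real.exp_pos _).le) (hw ε)
    have h2 := Real.log_le_sub_one_of_pos (div_pos (Real.exp_pos (τ * Z (w ε) ε)) hN)
    rw [Real.log_div (Real.exp_pos _).ne' hN.ne', Real.log_exp] at h2
    have h3 : Real.exp (τ * Z (w ε) ε) / W.card ≤
        (1 / (W.card : ℝ)) * ∑ k ∈ W, Real.exp (τ * Z k ε) := by
      rw [div_eq_mul_one_div, mul_comm]
      gcongr
    linarith
  have h4 := pathMean_mono n hpt
  rw [pathMean_mul, pathMean_add, pathMean_const, pathMean_sub, pathMean_mul,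
    pathMean_sum n W, pathMean_const] at h4
  have h5 : (1 / (W.card : ℝ)) * ∑ k ∈ W, pathMean n (fun ε => Real.exp (τ * Z k ε)) ≤ 1 :=
    calc _ ≤ (1 / (W.card : ℝ)) * ∑ _k ∈ W, (1 : ℝ) := by
          gcongr with k hk
          exact hexp k hk
      _ = 1 := by simp [hN.ne']
  rw [one_div, ← div_eq_inv_mul, le_div_iff₀ hτ]
  linarith

/-- Truncation to `[-d, d]`. -/
def clip (d x : ℝ) : ℝ := max (-d) (min d x)

theorem clip_sq_le {d : ℝ} (hd : 0 ≤ d) (x : ℝ) : clip d x ^ 2 ≤ d ^ 2 :=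
  sq_le_sq' (le_max_left _ _) (max_le (by linarith) (min_le_left _ _))

theorem clip_eq_self {d x : ℝ} (h : |x| ≤ d) : clip d x = x := by
  obtain ⟨h1, h2⟩ := abs_le.1 h
  rw [clip, min_eq_right h2, max_eq_right h1]

theorem abs_offset_le {η y : ℝ} (hη : 0 ≤ η) (hy : 0 ≤ y) (h : η * y ≤ 4) :
    |2 * y - η * y ^ 2| ≤ 2 * y := by
  rw [abs_le]
  have h1 : η * y * y ≤ 4 * y := by gcongr
  have h2 : 0 ≤ η * y ^ 2 := by positivity
  constructor <;> nlinarith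

/-- The chaining bound for the offset process along finite nets `W 0, …, W N`, where the elements
of `W 0` approximate the process `v` from below. -/
theorem pathMean_chaining_le {n : ℕ} (y : Tree ℝ n) {η ζ : ℝ} (hη : 0 < η)
    (hy : ∀ t p, 0 ≤ y t p ∧ η * y t p ≤ 4) (v : (Fin n → ℤˣ) → Fin n → ℝ) {N : ℕ}
    (W : ℕ → Finset (Tree ℝ n)) (ρ d lam : ℕ → ℝ)
    (hd : ∀ j < N, 0 < d j ∧ ρ j + ρ (j + 1) ≤ d j) (hlam : ∀ j < N, 0 < lam j)
    (hζ : 2 * ρ N ≤ ζ) (hmem : ∀ w ∈ W 0, ∀ t p, w t p ∈ Set.Icc (0 : ℝ) 1)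
    (hW₀ : ∀ ε, ∃ w ∈ W 0, ∀ t, w.value ε t ≤ v ε t ∧ |v ε t - w.value ε t| ≤ ρ 0)
    (hW : ∀ j, 1 ≤ j → j ≤ N → ∀ ε, ∃ w ∈ W j, ∀ t, |v ε t - w.value ε t| ≤ ρ j) :
    pathMean n (fun ε => ∑ t, (((ε t : ℤˣ) : ℤ) * (v ε t * (2 * y.value ε t - η * y.value ε t ^ 2))
        - η * v ε t * y.value ε t ^ 2
        - ((∑ j ∈ Finset.range N, lam j) * y.value ε t ^ 2 + ζ * y.value ε t))) ≤
      2 / η * Real.log (W 0).card + ∑ j ∈ Finset.range N,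
        2 * d j ^ 2 / lam j * Real.log ((W j).card * (W (j + 1)).card) := by
  have hsel : ∀ j, ∃ w : (Fin n → ℤˣ) → Tree ℝ n, j ≤ N → ∀ ε, w ε ∈ W j ∧
      ∀ t, |v ε t - (w ε).value ε t| ≤ ρ j ∧ (j = 0 → (w ε).value ε t ≤ v ε t) := by
    intro j
    rcases Nat.eq_zero_or_pos j with rfl | hj
    · choose w hw hw' using hW₀
      exact ⟨w, fun _ ε => ⟨hw ε, fun t => ⟨(hw' ε t).2, fun _ => (hw' ε t).1⟩⟩⟩
    · by_cases hjN : j ≤ N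
      · choose w hw hw' using hW j hj hjN
        exact ⟨w, fun _ ε => ⟨hw ε, fun t => ⟨hw' ε t, fun h => absurd h hj.ne'⟩⟩⟩
      · exact ⟨fun _ => y, fun h => absurd h hjN⟩
  choose w hw using hsel
  set ψ : ℝ → ℝ := fun y => 2 * y - η * y ^ 2
  have hψ : ∀ t p, |ψ (y t p)| ≤ 2 * y t p := fun t p =>
    abs_offset_le hη.le (hy t p).1 (hy t p).2
  have hψ2 : ∀ t p, ψ (y t p) ^ 2 ≤ 4 * y t p ^ 2 := fun t p => by
    have := sq_le_sq' (abs_le.1 (hψ t p)).1 (abs_le.1 (hψ t p)).2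
    linarith
  -- the coarsest level
  have hlevel₀ := pathMean_select_le (W 0) (fun k t p => k t p * ψ (y t p))
    (fun k t p => η * k t p * y t p ^ 2) (τ := η / 2) (by positivity) (fun k hk t p => by
      obtain ⟨h0, h1⟩ := hmem k hk t p
      -- Because weights lie in `[0,1]`, the variance is of order `k y²` and the offset `η k y²`
      -- absorbs it.
      have h2 : k t p ^ 2 ≤ k t p := by nlinarith
      calc η / 2 * (k t p * ψ (y t p)) ^ 2 / 2 = η / 4 * (k t p ^ 2 * ψ (y t p) ^ 2) := by ring
        _ ≤ η / 4 * (k t p * (4 * y t p ^ 2)) := by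
          gcongr
          exact hψ2 t p
        _ = _ := by ring) (w 0) (fun ε => (hw 0 N.zero_le ε).1)
  -- the links
  have hlink : ∀ j ∈ Finset.range N, _ := fun j hj =>
    pathMean_select_le (W j ×ˢ W (j + 1))
      -- All pairs from the two nets enter, even distant ones; truncation bounds every increment by
      -- `d j` and leaves the selected pairs unchanged.
      (fun k t p => clip (d j) (k.2 t p - k.1 t p) * ψ (y t p))
      (fun k t p => lam j * y t p ^ 2) (τ := lam j / (2 * d j ^ 2))
      (by
        have h1 := hd j (Finset.mem_range.1 hj)
        have h2 := hlam j (Finset.mem_range.1 hj)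
        have := h1.1
        positivity)
      (fun k _ t p => by
        have h1 := (hd j (Finset.mem_range.1 hj)).1
        have h2 := hlam j (Finset.mem_range.1 hj)
        calc lam j / (2 * d j ^ 2) * (clip (d j) (k.2 t p - k.1 t p) * ψ (y t p)) ^ 2 / 2 =
              lam j / (4 * d j ^ 2) * (clip (d j) (k.2 t p - k.1 t p) ^ 2 * ψ (y t p) ^ 2) := by
              field_simp
              ring
          _ ≤ lam j / (4 * d j ^ 2) * (d j ^ 2 * (4 * y t p ^ 2)) := by
            refine mul_le_mul_of_nonneg_left ?_ (by positivity)
            exact mul_le_mul (clip_sq_le h1.le _) (hψ2 t p) (sq_nonneg _) (sq_nonneg _)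
          _ = _ := by field_simp)
      (fun ε => (w j ε, w (j + 1) ε))
      (fun ε => Finset.mk_mem_product (hw j (Finset.mem_range.1 hj).le ε).1
        (hw (j + 1) (Finset.mem_range.1 hj) ε).1)
  have hsum := Finset.sum_le_sum hlink
  rw [← pathMean_sum] at hsum
  have htot := add_le_add hlevel₀ hsum
  rw [← pathMean_add] at htot
  refine le_trans (pathMean_mono n fun ε => ?_) (htot.trans (le_of_eq ?_))
  · rw [Finset.sum_comm, ← Finset.sum_add_distrib]
    refine Finset.sum_le_sum fun t _ => ?_
    set p : Fin (t : ℕ) → ℤˣ := fun i => ε (Fin.castLE t.isLt.le i) with hp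
    have hval : ∀ z : Tree ℝ n, z.value ε t = z t p := fun z => rfl
    simp only [hval] at hw ⊢
    set e : ℝ := (((ε t : ℤˣ) : ℤ) : ℝ) with he
    have he1 : |e| = 1 := by
      rcases Int.units_eq_one_or (ε t) with h | h <;> simp [he, h]
    have hclip : ∀ j ∈ Finset.range N, clip (d j) (w (j + 1) ε t p - w j ε t p) =
        w (j + 1) ε t p - w j ε t p := by
      intro j hj
      have hj := Finset.mem_range.1 hj
      apply clip_eq_self
      have h1 := abs_le.1 ((hw j hj.le ε).2 t).1
      have h2 := abs_le.1 ((hw (j + 1) hj ε).2 t).1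
      have h3 := (hd j hj).2
      simp only [hval] at h1 h2
      rw [abs_le]
      constructor <;> linarith [h1.1, h1.2, h2.1, h2.2]
    have hsum2 : ∑ j ∈ Finset.range N, (e * (clip (d j) (w (j + 1) ε t p - w j ε t p) * ψ (y t p))
        - lam j * y t p ^ 2) = e * ((w N ε t p - w 0 ε t p) * ψ (y t p)) -
          (∑ j ∈ Finset.range N, lam j) * y t p ^ 2 := by
      rw [Finset.sum_sub_distrib, ← Finset.sum_mul, ← Finset.mul_sum, ← Finset.sum_mul,
        Finset.sum_congr rfl hclip, Finset.sum_range_sub (fun j => w j ε t p)]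
    have h1 := ((hw 0 N.zero_le ε).2 t).2 rfl
    have h2 := ((hw N le_rfl ε).2 t).1
    simp only [hval] at h1 h2
    -- The error beyond the finest net is paid by the linear penalty.
    have h3 : e * ((v ε t - w N ε t p) * ψ (y t p)) ≤ ζ * y t p := by
      calc e * ((v ε t - w N ε t p) * ψ (y t p)) ≤ |e * ((v ε t - w N ε t p) * ψ (y t p))| :=
            le_abs_self _
        _ = |v ε t - w N ε t p| * |ψ (y t p)| := by rw [abs_mul, abs_mul, he1, one_mul]
        _ ≤ ρ N * (2 * y t p) := by
          gcongr
          · exact (abs_nonneg _).trans h2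
          · exact hψ t p
        _ = 2 * ρ N * y t p := by ring
        _ ≤ ζ * y t p := mul_le_mul_of_nonneg_right hζ (hy t p).1
    -- This needs `w 0` below `v`: the available offset then dominates the one used for the net.
    have h4 : η * w 0 ε t p * y t p ^ 2 ≤ η * v ε t * y t p ^ 2 := by gcongr
    change e * (v ε t * ψ (y t p)) - _ - _ ≤ e * (w 0 ε t p * ψ (y t p)) -
      η * w 0 ε t p * y t p ^ 2 + ∑ j ∈ Finset.range N,
        (e * (clip (d j) (w (j + 1) ε t p - w j ε t p) * ψ (y t p)) - lam j * y t p ^ 2)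
    rw [hsum2]
    linarith
  · congr 1
    · rw [one_div_div]
    · refine Finset.sum_congr rfl fun j _ => ?_
      rw [one_div_div, Finset.card_product, Nat.cast_mul]

/-! ### Finite covers -/

theorem exists_finset_isSeqCover {X : Type*} {K T : ℕ} {r : ℝ} {F : Set (X → Fin K → ℝ)}
    (h : seqEntropy r F T ≠ ⊤) (x : Tree X T) :
    ∃ V : Finset (Tree (Fin K → ℝ) T), IsSeqCover r F x V ∧
      Real.log V.card ≤ (seqEntropy r F T).toReal := by
  have hN : seqCoveringNumber r F T ≠ ⊤ := by
    intro htop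
    simp [seqEntropy, htop] at h
  obtain ⟨n, hn⟩ := ENat.ne_top_iff_exists.1 hN
  have hent : seqEntropy r F T = ENNReal.ofReal (Real.log n) := by
    rw [seqEntropy, ← hn]
    rcases Nat.eq_zero_or_pos n with rfl | hpos
    · simp
    · rw [ENat.toENNReal_coe, ← ENNReal.ofReal_natCast,
        ENNReal.log_ofReal_of_pos (by exact_mod_cast hpos), EReal.real_coe_toENNReal]
  -- Comparing with `n + 1` makes the inequality strict, so that an actual cover can be extracted
  -- from the infimum.
  have hx : seqCoveringNumberOn r F x < ((n + 1 : ℕ) : ℕ∞) := by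
    refine lt_of_le_of_lt ((le_iSup (fun x => seqCoveringNumberOn r F x) x).trans_eq hn.symm) ?_
    exact_mod_cast Nat.lt_succ_self n
  simp only [seqCoveringNumberOn, iInf_lt_iff] at hx
  obtain ⟨V, hV, hlt⟩ := hx
  have hfin : V.Finite := Set.encard_lt_top_iff.1 (hlt.trans (ENat.natCast_lt_top _))
  refine ⟨hfin.toFinset, by simpa using hV, ?_⟩
  rw [hent, ENNReal.toReal_ofReal (Real.log_natCast_nonneg n)]
  rw [hfin.encard_eq_coe_toFinset_card] at hlt
  have hle : hfin.toFinset.card ≤ n := by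
    have : hfin.toFinset.card < n + 1 := by exact_mod_cast hlt
    omega
  rcases Nat.eq_zero_or_pos hfin.toFinset.card with h0 | hpos
  · rw [h0]
    simpa using Real.log_natCast_nonneg n
  · exact Real.log_le_log (by exact_mod_cast hpos) (by exact_mod_cast hle)

theorem seqEntropy_antitone {X : Type*} {K : ℕ} (F : Set (X → Fin K → ℝ)) (T : ℕ) :
    Antitone fun r => seqEntropy r F T := by
  intro r r' hr
  refine EReal.toENNReal_le_toENNReal (ENNReal.log_monotone (ENat.toENNReal_mono ?_))
  refine iSup_mono fun x => le_iInf₂ fun V hV => iInf₂_le V fun g hg ε => ?_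
  obtain ⟨v, hv, h⟩ := hV g hg ε
  exact ⟨v, hv, fun t => (h t).trans hr⟩

/-! ### The ramp function -/

/-- The ramp function, equal to `0` below `-γ` and to `1` above `0`. -/
noncomputable def ramp (γ u : ℝ) : ℝ := max 0 (min 1 (1 + u / γ))

section Ramp

variable {γ : ℝ}

theorem ramp_mem (γ u : ℝ) : ramp γ u ∈ Set.Icc (0 : ℝ) 1 :=
  ⟨le_max_left _ _, max_le zero_le_one (min_le_left _ _)⟩

theorem ramp_mono (hγ : 0 < γ) {u u' : ℝ} (h : u ≤ u') : ramp γ u ≤ ramp γ u' := by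
  unfold ramp
  gcongr

theorem ramp_of_nonneg (hγ : 0 < γ) {u : ℝ} (h : 0 ≤ u) : ramp γ u = 1 := by
  have : 0 ≤ u / γ := by positivity
  rw [ramp, min_eq_left (by linarith), max_eq_right zero_le_one]

theorem ramp_of_lt (hγ : 0 < γ) {u : ℝ} (h : u < -γ) : ramp γ u = 0 := by
  have : u / γ < -1 := by
    rw [div_lt_iff₀ hγ]
    linarith
  exact max_eq_left ((min_le_right _ _).trans (by linarith))

theorem abs_ramp_sub_le (hγ : 0 < γ) (u u' : ℝ) : |ramp γ u - ramp γ u'| ≤ |u - u'| / γ := by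
  unfold ramp
  calc _ ≤ |min 1 (1 + u / γ) - min 1 (1 + u' / γ)| := by
        simpa using abs_max_sub_max_le_max 0 (min 1 (1 + u / γ)) 0 (min 1 (1 + u' / γ))
    _ ≤ |(1 + u / γ) - (1 + u' / γ)| := by
        simpa using abs_min_sub_min_le_max 1 (1 + u / γ) 1 (1 + u' / γ)
    _ = |u - u'| / γ := by
        rw [← abs_of_pos hγ, ← abs_div, abs_of_pos hγ]
        congr 1
        ring

theorem ramp_le_indicator (hγ : 0 < γ) (u : ℝ) [Decidable (-γ ≤ u)] :
    ramp γ u ≤ if -γ ≤ u then 1 else 0 := by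
  split_ifs with h
  · exact (ramp_mem γ u).2
  · exact (ramp_of_lt hγ (not_le.1 h)).le

theorem ramp_comp_mem_weightSet (hγ : 0 < γ) {K : ℕ} (hK : 1 ≤ K) {s : Fin K → ℝ}
    (hs : ∑ a, s a = 0) : (fun a => ramp γ (s a)) ∈ weightSet K := by
  refine ⟨⟨fun a => (ramp_mem γ _).1, fun a => (ramp_mem γ _).2⟩, ?_⟩
  have : Nonempty (Fin K) := ⟨⟨0, hK⟩⟩
  obtain ⟨a, -, ha⟩ := Finset.exists_le_of_sum_le (s := Finset.univ) (f := fun _ => (0 : ℝ))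
    (g := s) Finset.univ_nonempty (by simp [hs])
  calc (1 : ℝ) = ramp γ (s a) := (ramp_of_nonneg hγ ha).symm
    _ ≤ ∑ a, ramp γ (s a) := Finset.single_le_sum (f := fun a => ramp γ (s a))
        (fun a _ => (ramp_mem γ _).1) (Finset.mem_univ a)

end Ramp

/-! ### The value of the symmetrized game in terms of sequential entropies -/

/-- The comparators: the regressors in `F` composed with the ramp function. -/
noncomputable def rampClass {X : Type*} {K : ℕ} (γ : ℝ) (F : Set (X → Fin K → ℝ)) :
    F → X → Fin K → ℝ := fun f x a => ramp γ ((f : X → Fin K → ℝ) x a)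

theorem log_card_mul_card_le (m n : ℕ) :
    Real.log ((m : ℝ) * n) ≤ Real.log m + Real.log n := by
  rcases Nat.eq_zero_or_pos m with rfl | hm
  · simpa using Real.log_natCast_nonneg n
  rcases Nat.eq_zero_or_pos n with rfl | hn
  · simpa using Real.log_natCast_nonneg m
  rw [Real.log_mul (by positivity) (by positivity)]

/-- Levels 0 and 1 share the cover at scale `β / 2`, hence `max j 1`. At level 0 it is shifted down
by `β / 2`, which makes it a lower approximation at scale `β`. The ramp preserves this order and,
being `1/γ`-Lipschitz, turns the scales into `β / 2 ^ j / γ`. -/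
theorem dominated_of_entropy {X : Type*} {K T : ℕ} (F : Set (X → Fin K → ℝ))
    {β γ μ η ζ : ℝ} (hβ : 0 < β) (hγ : 0 < γ) (hμ : 0 < μ) (hη : 0 < η) (hημ : η ≤ 4 * μ)
    {N : ℕ} {lam : ℕ → ℝ} (hlam : ∀ j < N, 0 < lam j) (hζ : 2 * (β / 2 ^ N / γ) ≤ ζ)
    (hent : ∀ j ≤ N, seqEntropy (β / 2 ^ max j 1) F T ≠ ⊤) :
    Dominated (banditPayoff μ (rampClass γ F) η (∑ j ∈ Finset.range N, lam j) ζ) T (fun _ => 0)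
      (2 / η * (seqEntropy (β / 2) F T).toReal + ∑ j ∈ Finset.range N,
        2 * (3 * (β / 2 ^ (j + 1)) / γ) ^ 2 / lam j *
          (2 * (seqEntropy (β / 2 ^ (j + 1)) F T).toReal)) := by
  classical
  intro z σ
  let x : Tree X T := z.map Prod.fst
  let act : Tree (Fin K) T := z.map fun m => m.2.1
  let y : Tree ℝ T := z.map fun m => (m.2.2 : ℝ)
  have hcov : ∀ j, ∃ V : Finset (Tree (Fin K → ℝ) T), j ≤ N →
      IsSeqCover (β / 2 ^ max j 1) F x V ∧
        Real.log V.card ≤ (seqEntropy (β / 2 ^ max j 1) F T).toReal := by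
    intro j
    by_cases hj : j ≤ N
    · obtain ⟨V, hV⟩ := exists_finset_isSeqCover (hent j hj) x
      exact ⟨V, fun _ => hV⟩
    · exact ⟨∅, fun h => absurd h hj⟩
  choose V hV using hcov
  let shift : ℕ → ℝ := fun j => if j = 0 then β / 2 else 0
  let net : ℕ → Tree (Fin K → ℝ) T → Tree ℝ T := fun j v t p =>
    ramp γ (v t p (act t p) - shift j)
  let W : ℕ → Finset (Tree ℝ T) := fun j => (V j).image (net j)
  have hlog : ∀ j ≤ N, Real.log (W j).card ≤ (seqEntropy (β / 2 ^ max j 1) F T).toReal := by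
    intro j hj
    refine le_trans ?_ (hV j hj).2
    rcases Nat.eq_zero_or_pos (W j).card with h0 | hpos
    · rw [h0]
      simpa using Real.log_natCast_nonneg _
    · exact Real.log_le_log (by exact_mod_cast hpos) (by exact_mod_cast Finset.card_image_le)
  have hmono : ∀ j ≤ N, ∀ j' ≤ N, j ≤ j' → (seqEntropy (β / 2 ^ max j 1) F T).toReal ≤
      (seqEntropy (β / 2 ^ max j' 1) F T).toReal := by
    intro j _ j' hj' hjj
    refine ENNReal.toReal_mono (hent j' hj') (seqEntropy_antitone F T ?_)
    have : max j 1 ≤ max j' 1 := max_le_max_right 1 hjj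
    gcongr
    norm_num
  have hy : ∀ t p, 0 ≤ y t p ∧ η * y t p ≤ 4 := by
    intro t p
    have h1 : 0 ≤ y t p := (z t p).2.2.2.1
    have h2 : y t p ≤ 1 / μ := (z t p).2.2.2.2
    refine ⟨h1, ?_⟩
    calc η * y t p ≤ 4 * μ * (1 / μ) := by gcongr
      _ = 4 := by field_simp
  have hclose : ∀ j ≤ N, ∀ ε, ∃ v ∈ V j, ∀ t, |(σ ε : X → Fin K → ℝ) (x.value ε t)
      (act.value ε t) - v.value ε t (act.value ε t)| ≤ β / 2 ^ max j 1 := by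
    intro j hj ε
    obtain ⟨v, hv, h⟩ := (hV j hj).1 (σ ε) (σ ε).2 ε
    exact ⟨v, hv, fun t => (norm_le_pi_norm
      ((σ ε : X → Fin K → ℝ) (x.value ε t) - v.value ε t) (act.value ε t)).trans (h t)⟩
  have hchain := pathMean_chaining_le y hη hy
    (fun ε t => ramp γ ((σ ε : X → Fin K → ℝ) (x.value ε t) (act.value ε t))) (N := N) W
    (fun j => β / 2 ^ j / γ) (fun j => 3 * (β / 2 ^ (j + 1)) / γ) lam
    -- `d j` is exactly the sum of the radii at levels `j` and `j + 1`.
    (fun j _ => ⟨by positivity, le_of_eq (by field_simp; ring)⟩) hlam hζ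
    (fun w hw t p => by
      obtain ⟨v, -, rfl⟩ := Finset.mem_image.1 hw
      exact ramp_mem _ _)
    (fun ε => by
      obtain ⟨v, hv, h⟩ := hclose 0 N.zero_le ε
      refine ⟨net 0 v, Finset.mem_image_of_mem _ hv, fun t => ?_⟩
      have h1 := abs_le.1 (h t)
      simp only [zero_le, sup_of_le_right, pow_one] at h1
      have h2 : (net 0 v).value ε t = ramp γ (v.value ε t (act.value ε t) - β / 2) := rfl
      rw [h2]
      refine ⟨ramp_mono hγ (by linarith [h1.1]), (abs_ramp_sub_le hγ _ _).trans ?_⟩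
      rw [pow_zero, div_one]
      gcongr
      rw [abs_le]
      constructor <;> linarith [h1.1, h1.2])
    (fun j hj hjN ε => by
      obtain ⟨v, hv, h⟩ := hclose j hjN ε
      refine ⟨net j v, Finset.mem_image_of_mem _ hv, fun t => ?_⟩
      have h2 : (net j v).value ε t = ramp γ (v.value ε t (act.value ε t) - shift j) := rfl
      have h3 : shift j = 0 := if_neg (by omega)
      rw [h2, h3, sub_zero]
      refine (abs_ramp_sub_le hγ _ _).trans ?_
      have := h t
      rw [max_eq_left hj] at this
      gcongr)
  refine le_trans (le_of_eq ?_) (hchain.trans (add_le_add ?_ (Finset.sum_le_sum fun j hj => ?_)))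
  · unfold continuationValue
    congr 1
    funext ε
    rw [zero_add]
    refine Finset.sum_congr rfl fun t _ => ?_
    simp only [banditPayoff, symPayoff, Estimate.vec, Estimate.vecSub, Estimate.pen,
      dotProduct_single]
    change _ * (ramp γ ((σ ε : X → Fin K → ℝ) (x.value ε t) (act.value ε t)) *
      (y.value ε t - η * y.value ε t ^ 2) +
      ramp γ ((σ ε : X → Fin K → ℝ) (x.value ε t) (act.value ε t)) * y.value ε t) -
      (ramp γ ((σ ε : X → Fin K → ℝ) (x.value ε t) (act.value ε t)) * y.value ε t -
      ramp γ ((σ ε : X → Fin K → ℝ) (x.value ε t) (act.value ε t)) *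
      (y.value ε t - η * y.value ε t ^ 2)) -
      ((∑ j ∈ Finset.range N, lam j) * y.value ε t ^ 2 + ζ * y.value ε t) = _
    ring
  · gcongr
    simpa using hlog 0 N.zero_le
  · have hj' := Finset.mem_range.1 hj
    have h1 := hlog j hj'.le
    have h2 := hlog (j + 1) hj'
    have h3 := hmono j hj'.le (j + 1) hj' (Nat.le_succ j)
    have h4 := log_card_mul_card_le (W j).card (W (j + 1)).card
    rw [max_eq_left (Nat.le_add_left 1 j)] at h2 h3
    have h5 := hlam j hj'
    gcongr
    linarith

/-! ### Tuning -/

/-- The tuning of the rate of the coarsest level. -/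
theorem rate_tuning {L k μ δ : ℝ} (hL : 0 ≤ L) (hk : 0 < k) (hμ : 0 < μ) (hδ : 0 < δ) :
    2 / min (4 * μ) (√(L / k) + δ) * L + 2 * min (4 * μ) (√(L / k) + δ) * k ≤
      4 * √(2 * k * L) + 8 / μ * L + 2 * δ * k := by
  set r := √(L / k)
  have hr : 0 ≤ r := Real.sqrt_nonneg _
  have hrL : L = r ^ 2 * k := by
    rw [Real.sq_sqrt (by positivity)]
    field_simp
  -- In fact `r * k = √(k * L)`; the factor 2 under the root is slack.
  have hrk : r * k ≤ √(2 * k * L) := by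
    refine Real.le_sqrt_of_sq_le ?_
    rw [hrL]
    nlinarith [mul_nonneg (sq_nonneg r) (sq_nonneg k)]
  have h1 : 2 / min (4 * μ) (r + δ) * L ≤ 8 / μ * L + 2 * (r * k) := by
    rcases min_cases (4 * μ) (r + δ) with ⟨h, -⟩ | ⟨h, -⟩
    · rw [h]
      have e : 2 / (4 * μ) ≤ 8 / μ := by
        rw [div_le_div_iff₀ (by positivity) hμ]
        linarith
      have := mul_le_mul_of_nonneg_right e hL
      have : 0 ≤ r * k := by positivity
      linarith
    · rw [h]
      have e : 2 / (r + δ) * L ≤ 2 * (r * k) := by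
        rw [div_mul_eq_mul_div, div_le_iff₀ (by positivity), hrL]
        nlinarith [mul_nonneg (mul_nonneg hr hk.le) hδ.le]
      have : 0 ≤ 8 / μ * L := by positivity
      linarith
  have h2 : 2 * min (4 * μ) (r + δ) * k ≤ 2 * (r + δ) * k := by
    gcongr
    exact min_le_right _ _
  linarith

/-- The tuning of the penalty of one link of the chain. -/
theorem link_tuning {L q d δ : ℝ} (hL : 0 ≤ L) (hq : 0 < q) (hd : 0 ≤ d) (hδ : 0 < δ) :
    2 * d ^ 2 / (2 * d * √L / √q + δ) * (2 * L) + (2 * d * √L / √q + δ) * q ≤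
      4 * d * √L * √q + δ * q := by
  have hs : 0 ≤ √L := Real.sqrt_nonneg _
  have hu : 0 < √q := Real.sqrt_pos.2 hq
  have hs2 : L = √L ^ 2 := (Real.sq_sqrt hL).symm
  have hu2 : q = √q ^ 2 := (Real.sq_sqrt hq.le).symm
  set s := √L
  set u := √q
  -- Without `δ` the penalty `2 d √L / √q` balances the two summands at `2 d √L √q`; `δ` keeps it
  -- positive when `L = 0`.
  have e1 : 2 * d * s / u * q = 2 * d * s * u := by
    rw [hu2]
    field_simp
  have e2 : 2 * d ^ 2 / (2 * d * s / u + δ) * (2 * L) ≤ 2 * d * s * u := by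
    rw [div_mul_eq_mul_div, div_le_iff₀ (by positivity), hs2, mul_add]
    have e3 : 2 * d * s * u * (2 * d * s / u) = 2 * d ^ 2 * (2 * s ^ 2) := by
      field_simp
    have : 0 ≤ 2 * d * s * u * δ := by positivity
    linarith
  linarith

/-- The lower Riemann sum of the entropy integral along the dyadic scales. -/
theorem sum_le_lintegral {α β : ℝ} {N : ℕ} (hβ : 0 < β) (hN : ∀ j < N, α ≤ β / 2 ^ (j + 2))
    {φ : ℝ → ℝ≥0∞} (hφ : Antitone φ) :
    ∑ j ∈ Finset.range N, ENNReal.ofReal (β / 2 ^ (j + 2)) * φ (β / 2 ^ (j + 1)) ≤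
      ∫⁻ ε in Set.Icc α β, φ ε := by
  let J : ℕ → Set ℝ := fun j => Set.Ioc (β / 2 ^ (j + 2)) (β / 2 ^ (j + 1))
  have hanti : Antitone fun j : ℕ => β / 2 ^ (j + 1) := by
    intro i j hij
    dsimp only
    gcongr
    norm_num
  have hdisj : Pairwise (Function.onFun Disjoint J) :=
    hanti.pairwise_disjoint_on_Ioc_succ
  have hsub : ⋃ j ∈ Finset.range N, J j ⊆ Set.Icc α β := by
    simp only [Set.iUnion_subset_iff, Finset.mem_range]
    rintro j hj ε ⟨h1, h2⟩
    refine ⟨(hN j hj).trans h1.le, h2.trans (div_le_self hβ.le ?_)⟩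
    exact one_le_pow₀ (by norm_num)
  calc _ ≤ ∑ j ∈ Finset.range N, ∫⁻ ε in J j, φ ε := by
        refine Finset.sum_le_sum fun j _ => ?_
        have hvol : MeasureTheory.volume (J j) = ENNReal.ofReal (β / 2 ^ (j + 2)) := by
          rw [Real.volume_Ioc]
          congr 1
          field_simp
          ring
        rw [← hvol, mul_comm, ← MeasureTheory.setLIntegral_const]
        exact MeasureTheory.setLIntegral_mono' measurableSet_Ioc fun ε hε => hφ hε.2
    _ = ∫⁻ ε in ⋃ j ∈ Finset.range N, J j, φ ε :=
        (MeasureTheory.lintegral_biUnion_finset (fun i _ j _ hij => hdisj hij)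
          (fun j _ => measurableSet_Ioc) φ).symm
    _ ≤ _ := MeasureTheory.lintegral_mono_set hsub

/-! ### The margin bound -/

/-- Minimality of `N` gives `β / 2 ^ j > 4α` for `j < N`, which keeps the intervals of the Riemann
sum above `α`. -/
theorem exists_pow_scale {α β : ℝ} (hα : 0 < α) :
    ∃ N : ℕ, β / 2 ^ N ≤ 4 * α ∧ ∀ j < N, α ≤ β / 2 ^ (j + 2) := by
  classical
  have hex : ∃ N : ℕ, β / 2 ^ N ≤ 4 * α := by
    obtain ⟨N, hN⟩ := pow_unbounded_of_one_lt (β / (4 * α)) (one_lt_two (α := ℝ))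
    refine ⟨N, ?_⟩
    rw [div_lt_iff₀ (by positivity)] at hN
    rw [div_le_iff₀ (by positivity)]
    linarith
  refine ⟨Nat.find hex, Nat.find_spec hex, fun j hj => ?_⟩
  have h := not_le.1 (Nat.find_min hex hj)
  have e : β / 2 ^ (j + 2) = β / 2 ^ j / 4 := by
    rw [pow_add, ← div_div]
    norm_num
  rw [e]
  linarith

theorem Adversary.sum_ramp_le_marginLoss {X : Type*} {K T : ℕ} (A : Adversary X K) {γ : ℝ}
    (hγ : 0 < γ) (f : X → Fin K → ℝ) (a : Fin T → Fin K) :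
    ∑ s, ∑ b, A.lossAt a s b * ramp γ (f (A.contextAt a s) b) ≤ A.marginLoss γ f a := by
  unfold Adversary.marginLoss
  refine Finset.sum_le_sum fun s _ => Finset.sum_le_sum fun b _ => ?_
  exact mul_le_mul_of_nonneg_left (ramp_le_indicator hγ _) (A.loss_mem _ _ _).1

theorem ofReal_mul_sqrt_toReal {b : ℝ} (hb : 0 ≤ b) {x : ℝ≥0∞} (hx : x ≠ ⊤) :
    ENNReal.ofReal (b * √x.toReal) = ENNReal.ofReal b * x ^ (1 / 2 : ℝ) := by
  rw [ENNReal.ofReal_mul hb, Real.sqrt_eq_rpow,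
    ← ENNReal.ofReal_rpow_of_nonneg ENNReal.toReal_nonneg (by norm_num), ENNReal.ofReal_toReal hx]

/-- The penalty of the `j`-th of `N` links, whose net has log-cardinality of order `L`. -/
noncomputable def linkPenalty (α β γ μ K T : ℝ) (N j : ℕ) (L : ℝ) : ℝ :=
  2 * (3 * (β / 2 ^ (j + 1)) / γ) * √L / √(K * T / μ) + α * μ / (γ * (N + 1))

theorem linkPenalty_pos {α β γ μ K T : ℝ} (hα : 0 < α) (hβ : 0 < β) (hγ : 0 < γ) (hμ : 0 < μ)
    (hK : 0 < K) (hT : 0 < T) (N j : ℕ) (L : ℝ) : 0 < linkPenalty α β γ μ K T N j L := by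
  unfold linkPenalty
  positivity

/-- The `η` terms, the links and the residual are tuned separately; `q = KT/μ` is the total cost of
one unit of `λ`. The slack in `η` and the slacks in all link penalties together each cost at most
`αKT/γ`. -/
theorem regret_tuning {α β γ μ K T L₀ J : ℝ} {L : ℕ → ℝ} {N : ℕ} (hα : 0 < α) (hβ : 0 < β)
    (hγ : 0 < γ) (hμ : 0 < μ) (hK0 : 0 < K) (hT0 : 0 < T) (hNα : β / 2 ^ N ≤ 4 * α)
    (hL₀0 : 0 ≤ L₀) (hL0 : ∀ j, 0 ≤ L j)
    (hriem : ∑ j ∈ Finset.range N, β / 2 ^ (j + 2) * √(L j) ≤ J) (hJ : 0 ≤ J) :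
    2 / min (4 * μ) (√(L₀ / (K ^ 2 * T)) + α / (2 * γ * K)) * L₀ +
        ∑ j ∈ Finset.range N, 2 * (3 * (β / 2 ^ (j + 1)) / γ) ^ 2 /
          linkPenalty α β γ μ K T N j (L j) * (2 * L j) +
        T * (K * (μ + 2 * min (4 * μ) (√(L₀ / (K ^ 2 * T)) + α / (2 * γ * K)) * K +
          (∑ j ∈ Finset.range N, linkPenalty α β γ μ K T N j (L j)) / μ +
          2 * (β / 2 ^ N / γ))) ≤
      4 * √(2 * K ^ 2 * T * L₀) + μ * K * T + 8 / μ * L₀ +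
        1 / γ * (3 * Real.exp 1 ^ 2 * α * K * T + 24 * Real.exp 1 * √(K * T / μ) * J) := by
  set q : ℝ := K * T / μ with hq
  have hq0 : 0 < q := by positivity
  set k : ℝ := K ^ 2 * T with hk
  have hk0 : 0 < k := by positivity
  set δ : ℝ := α / (2 * γ * K) with hδ
  set δ' : ℝ := α * μ / (γ * (N + 1)) with hδ'
  have hδ0 : 0 < δ := by positivity
  have hδ'0 : 0 < δ' := by positivity
  set η : ℝ := min (4 * μ) (√(L₀ / k) + δ) with hη
  set ζ : ℝ := 2 * (β / 2 ^ N / γ) with hζ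
  set d : ℕ → ℝ := fun j => 3 * (β / 2 ^ (j + 1)) / γ with hd
  have hd0 : ∀ j, 0 ≤ d j := fun j => by positivity
  set lam : ℕ → ℝ := fun j => linkPenalty α β γ μ K T N j (L j) with hlam
  have h1 := rate_tuning hL₀0 hk0 hμ hδ0
  rw [← hη] at h1
  have h2 : 2 * δ * k = 1 / γ * (α * K * T) := by
    rw [hδ, hk]
    field_simp
  have h3 : ζ * (K * T) ≤ 1 / γ * (8 * α * K * T) := by
    calc ζ * (K * T) = 2 * (β / 2 ^ N) * (K * T) / γ := by rw [hζ]; ring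
      _ ≤ 2 * (4 * α) * (K * T) / γ := by gcongr
      _ = _ := by ring
  have h4 : ∑ j ∈ Finset.range N, (2 * d j ^ 2 / lam j * (2 * L j) + lam j * q) ≤
      1 / γ * (24 * √q * J) + 1 / γ * (α * K * T) := by
    calc _ ≤ ∑ j ∈ Finset.range N, (4 * d j * √(L j) * √q + δ' * q) :=
          Finset.sum_le_sum fun j _ => link_tuning (hL0 j) hq0 (hd0 j) hδ'0
      _ = 1 / γ * (24 * √q * ∑ j ∈ Finset.range N, β / 2 ^ (j + 2) * √(L j)) +
          N * (δ' * q) := by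
          rw [Finset.sum_add_distrib, Finset.sum_const, Finset.card_range, nsmul_eq_mul,
            Finset.mul_sum, Finset.mul_sum]
          congr 1
          refine Finset.sum_congr rfl fun j _ => ?_
          -- The constant 24 arises here: `4 * d j = 24 * (β / 2 ^ (j + 2)) / γ`.
          rw [hd, pow_succ _ (j + 1)]
          field_simp
          ring
      _ ≤ _ := by
          refine add_le_add (by gcongr) ?_
          have e : N * (δ' * q) = N / (N + 1) * (1 / γ * (α * K * T)) := by
            rw [hδ', hq]
            field_simp
          rw [e]
          refine mul_le_of_le_one_left (by positivity) ?_
          rw [div_le_one (by positivity)]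
          linarith
  have h5 : (2 : ℝ) ≤ Real.exp 1 := by
    have := Real.add_one_le_exp 1
    linarith
  -- Here `10 = 8 + 1 + 1`, from the residual and the two slacks, while `3e² ≥ 12`.
  have h6 : 1 / γ * (10 * α * K * T) ≤ 1 / γ * (3 * Real.exp 1 ^ 2 * α * K * T) := by
    gcongr
    nlinarith
  have h7 : 1 / γ * (24 * √q * J) ≤ 1 / γ * (24 * Real.exp 1 * √q * J) := by
    gcongr
    linarith
  rw [Finset.sum_add_distrib, ← Finset.sum_mul] at h4
  have e1 : T * (K * (μ + 2 * η * K + (∑ j ∈ Finset.range N, lam j) / μ + ζ)) =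
      μ * K * T + 2 * η * k + (∑ j ∈ Finset.range N, lam j) * q + ζ * (K * T) := by
    rw [hk, hq]
    ring
  have e2 : 2 * K ^ 2 * T * L₀ = 2 * k * L₀ := by
    rw [hk]
    ring
  rw [e1, e2]
  linarith

theorem exists_strategy_of_entropy {X : Type*} {K T : ℕ} (hK : 1 ≤ K) (hT : 1 ≤ T)
    {F : Set (X → Fin K → ℝ)} (hF : ∀ f ∈ F, ∀ x, ∑ i, f x i = 0) {α β μ γ : ℝ} (hα : 0 < α)
    (hαβ : α < β) (hμ : 0 < μ) (hKμ : K * μ ≤ 1) (hγ : 0 < γ)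
    (hent : seqEntropy (β / 2) F T ≠ ⊤)
    (hint : ∫⁻ ε in Set.Icc α β, seqEntropy ε F T ^ (1 / 2 : ℝ) ≠ ⊤) :
    ∃ S : Strategy X K, ∀ (A : Adversary X K), ∀ f ∈ F,
      ∑ a : Fin T → Fin K, (actionLaw S A T a).toReal * A.cumLoss a ≤
        ∑ a : Fin T → Fin K, (actionLaw S A T a).toReal * A.marginLoss γ f a +
        (4 * √(2 * K ^ 2 * T * (seqEntropy (β / 2) F T).toReal) + μ * K * T +
          8 / μ * (seqEntropy (β / 2) F T).toReal + 1 / γ * (3 * Real.exp 1 ^ 2 * α * K * T +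
            24 * Real.exp 1 * √(K * T / μ) *
              (∫⁻ ε in Set.Icc α β, seqEntropy ε F T ^ (1 / 2 : ℝ)).toReal)) := by
  have hβ : 0 < β := hα.trans hαβ
  have hK0 : (0 : ℝ) < K := by exact_mod_cast hK
  have hT0 : (0 : ℝ) < T := by exact_mod_cast hT
  obtain ⟨N, hNα, hN⟩ := exists_pow_scale (β := β) hα
  have hanti : Antitone fun ε => seqEntropy ε F T ^ (1 / 2 : ℝ) := fun ε ε' h =>
    ENNReal.rpow_le_rpow (seqEntropy_antitone F T h) (by norm_num)
  have hsum := sum_le_lintegral hβ hN hanti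
  set I := ∫⁻ ε in Set.Icc α β, seqEntropy ε F T ^ (1 / 2 : ℝ) with hI
  -- A finite integral forces finite entropy at each scale, since each enters the lower sum with
  -- positive width.
  have hfin : ∀ j < N, seqEntropy (β / 2 ^ (j + 1)) F T ≠ ⊤ := by
    intro j hj htop
    have h1 := (Finset.single_le_sum (f := fun j => ENNReal.ofReal (β / 2 ^ (j + 2)) *
      seqEntropy (β / 2 ^ (j + 1)) F T ^ (1 / 2 : ℝ)) (fun _ _ => zero_le)
      (Finset.mem_range.2 hj)).trans hsum
    have hpos : 0 < β / 2 ^ (j + 2) := by positivity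
    simp only [htop] at h1
    rw [ENNReal.top_rpow_of_pos (by norm_num), ENNReal.mul_top (by simpa using hpos)] at h1
    exact hint (top_le_iff.1 h1)
  set L : ℕ → ℝ := fun j => (seqEntropy (β / 2 ^ (j + 1)) F T).toReal with hL
  set L₀ := (seqEntropy (β / 2) F T).toReal with hL₀
  have hL0 : ∀ j, 0 ≤ L j := fun j => ENNReal.toReal_nonneg
  have hL₀0 : 0 ≤ L₀ := ENNReal.toReal_nonneg
  have hriem : ∑ j ∈ Finset.range N, β / 2 ^ (j + 2) * √(L j) ≤ I.toReal := by
    rw [← ENNReal.ofReal_le_iff_le_toReal hint,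
      ENNReal.ofReal_sum_of_nonneg fun j _ => by positivity]
    refine le_of_eq_of_le (Finset.sum_congr rfl fun j hj => ?_) hsum
    exact ofReal_mul_sqrt_toReal (by positivity) (hfin j (Finset.mem_range.1 hj))
  have hent' : ∀ j ≤ N, seqEntropy (β / 2 ^ max j 1) F T ≠ ⊤ := by
    rintro (_ | j) hj
    · simpa using hent
    · rw [max_eq_left (Nat.le_add_left 1 j)]
      exact hfin j hj
  have hdom := dominated_of_entropy F hβ hγ hμ
    (η := min (4 * μ) (√(L₀ / (K ^ 2 * T)) + α / (2 * γ * K)))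
    (lt_min (by positivity) (by positivity)) (min_le_left _ _)
    (fun j _ => linkPenalty_pos hα hβ hγ hμ hK0 hT0 N j (L j))
    (ζ := 2 * (β / 2 ^ N / γ)) le_rfl hent'
  obtain ⟨S, hS⟩ := exists_strategy_of_dominated (g := rampClass γ F) hK hμ hKμ
    (fun f x => ramp_comp_mem_weightSet hγ hK (hF f.1 f.2 x))
    (le_min (by positivity) (by positivity))
    (Finset.sum_nonneg fun j _ => (linkPenalty_pos hα hβ hγ hμ hK0 hT0 N j (L j)).le)
    (by positivity) hdom
  refine ⟨S, fun A f hf => (hS A ⟨f, hf⟩).trans (add_le_add ?_ ?_)⟩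
  · exact Finset.sum_le_sum fun a _ => mul_le_mul_of_nonneg_left
      (A.sum_ramp_le_marginLoss hγ f a) ENNReal.toReal_nonneg
  · exact regret_tuning hα hβ hγ hμ hK0 hT0 hNα hL₀0 hL0 hriem ENNReal.toReal_nonneg

/-- Passing from real averages over the actions to expectations over the adversary's seed. -/
theorem expectation_le_of_forall_adversary {X Ω : Type*} {K : ℕ} [MeasurableSpace Ω]
    (P : MeasureTheory.Measure Ω) [MeasureTheory.IsProbabilityMeasure P] (S : Strategy X K)
    (A : Ω → Adversary X K) (T : ℕ) {Φ Ψ : Adversary X K → (Fin T → Fin K) → ℝ}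
    (hΦ : ∀ B a, 0 ≤ Φ B a) (hΨ : ∀ B a, 0 ≤ Ψ B a) {C : ℝ}
    (h : ∀ B, ∑ a, (actionLaw S B T a).toReal * Φ B a ≤
      ∑ a, (actionLaw S B T a).toReal * Ψ B a + C) :
    expectation P S A T Φ ≤ expectation P S A T Ψ + ENNReal.ofReal C := by
  have hconv : ∀ (Φ : Adversary X K → (Fin T → Fin K) → ℝ), (∀ B a, 0 ≤ Φ B a) → ∀ B,
      ∑ a, actionLaw S B T a * ENNReal.ofReal (Φ B a) =
        ENNReal.ofReal (∑ a, (actionLaw S B T a).toReal * Φ B a) := by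
    intro Φ hΦ B
    rw [ENNReal.ofReal_sum_of_nonneg fun a _ => mul_nonneg ENNReal.toReal_nonneg (hΦ B a)]
    refine Finset.sum_congr rfl fun a _ => ?_
    rw [ENNReal.ofReal_mul ENNReal.toReal_nonneg,
      ENNReal.ofReal_toReal ((actionLaw S B T).apply_ne_top a)]
  unfold expectation
  simp only [hconv Φ hΦ, hconv Ψ hΨ]
  calc _ ≤ ∫⁻ ω, (ENNReal.ofReal (∑ a, (actionLaw S (A ω) T a).toReal * Ψ (A ω) a) +
        ENNReal.ofReal C) ∂P := MeasureTheory.lintegral_mono fun ω =>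
          (ENNReal.ofReal_le_ofReal (h (A ω))).trans ENNReal.ofReal_add_le
    _ = _ := by
        -- Only the constant summand has to be measurable, so nothing is asked of the dependence on
        -- the seed.
        rw [MeasureTheory.lintegral_add_right _ measurable_const, MeasureTheory.lintegral_const,
          MeasureTheory.measure_univ, mul_one]

theorem Adversary.cumLoss_mem {X : Type*} {K T : ℕ} (A : Adversary X K) (a : Fin T → Fin K) :
    A.cumLoss a ∈ Set.Icc (0 : ℝ) T := by
  refine ⟨Finset.sum_nonneg fun t _ => (A.loss_mem _ _ _).1, ?_⟩
  calc A.cumLoss a ≤ ∑ _t : Fin T, (1 : ℝ) := Finset.sum_le_sum fun t _ => (A.loss_mem _ _ _).2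
    _ = T := by simp

theorem Adversary.marginLoss_nonneg {X : Type*} {K T : ℕ} (A : Adversary X K) (γ : ℝ)
    (f : X → Fin K → ℝ) (a : Fin T → Fin K) : 0 ≤ A.marginLoss γ f a := by
  refine Finset.sum_nonneg fun t _ => Finset.sum_nonneg fun i _ =>
    mul_nonneg (A.loss_mem _ _ _).1 ?_
  split_ifs
  · exact zero_le_one
  · exact le_rfl

/-- Any strategy has expected loss at most the number of rounds. -/
theorem expectation_cumLoss_le {X Ω : Type*} {K : ℕ} [MeasurableSpace Ω]
    (P : MeasureTheory.Measure Ω) [MeasureTheory.IsProbabilityMeasure P] (S : Strategy X K)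
    (A : Ω → Adversary X K) (T : ℕ) :
    expectation P S A T (fun B a => B.cumLoss a) ≤ T := by
  have h := expectation_le_of_forall_adversary P S A T (Φ := fun B a => B.cumLoss a)
    (Ψ := fun _ _ => 0) (C := T) (fun B a => (B.cumLoss_mem a).1) (fun _ _ => le_rfl) fun B => by
      calc _ ≤ ∑ a, (actionLaw S B T a).toReal * (T : ℝ) := Finset.sum_le_sum fun a _ =>
            mul_le_mul_of_nonneg_left (B.cumLoss_mem a).2 ENNReal.toReal_nonneg
        _ = _ := by
            rw [← Finset.sum_mul, sum_toReal_pmf]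
            simp
  simpa [expectation] using h

end ContextualBandit

/-- Outside the degenerate cases, one strategy satisfies the bound against every deterministic
adversary and every `f`. Integrating over the seed for fixed `f` and then taking the infimum gives
the claim. -/
theorem theorem2 {X : Type*} (K T : ℕ) (hK : 1 ≤ K)
    (F : Set (X → Fin K → ℝ)) (hF : ∀ f ∈ F, ∀ x, ∑ i, f x i = 0)
    (α β μ γ : ℝ) (hα : 0 < α) (hαβ : α < β) (hμ : μ ∈ Set.Ioo (0 : ℝ) 1) (hγ : 0 < γ) :
    ∃ S : ContextualBandit.Strategy X K,
      ∀ (Ω : Type*) [MeasurableSpace Ω] (P : MeasureTheory.Measure Ω)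
        [MeasureTheory.IsProbabilityMeasure P] (A : Ω → ContextualBandit.Adversary X K),
        ContextualBandit.expectation P S A T (fun B a => B.cumLoss a) ≤
          (⨅ f ∈ F, ContextualBandit.expectation P S A T (fun B a => B.marginLoss γ f a))
          + 4 * (2 * (K : ℝ≥0∞) ^ 2 * T * ContextualBandit.seqEntropy (β / 2) F T) ^ (1 / 2 : ℝ)
          + ENNReal.ofReal (μ * K * T)
          + ENNReal.ofReal (8 / μ) * ContextualBandit.seqEntropy (β / 2) F T
          + ENNReal.ofReal (1 / γ) *
            (ENNReal.ofReal (3 * Real.exp 1 ^ 2 * α * K * T)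
              + ENNReal.ofReal (24 * Real.exp 1 * Real.sqrt (K * T / μ)) *
                ∫⁻ ε in Set.Icc α β,
                  ContextualBandit.seqEntropy ε F T ^ (1 / 2 : ℝ)) := by
  have hμ0 := hμ.1
  have hK0 : (0 : ℝ) < K := by exact_mod_cast hK
  have hS₀ : Nonempty (ContextualBandit.Strategy X K) :=
    ⟨fun _ _ _ => PMF.pure ⟨0, hK⟩⟩
  rcases Nat.eq_zero_or_pos T with rfl | hT
  · refine ⟨hS₀.some, fun Ω _ P _ A => ?_⟩
    refine (ContextualBandit.expectation_cumLoss_le P _ A 0).trans ?_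
    simp
  have hT0 : (0 : ℝ) < T := by exact_mod_cast hT
  -- Exploration at rate `μ` is then impossible, but `μ K T` already exceeds the trivial bound `T`.
  by_cases hKμ : 1 < K * μ
  · refine ⟨hS₀.some, fun Ω _ P _ A => ?_⟩
    refine (ContextualBandit.expectation_cumLoss_le P _ A T).trans ?_
    have h : (T : ℝ≥0∞) ≤ ENNReal.ofReal (μ * K * T) := by
      rw [← ENNReal.ofReal_natCast]
      exact ENNReal.ofReal_le_ofReal (by nlinarith)
    exact h.trans (le_add_left le_rfl |>.trans (le_self_add.trans le_self_add))
  push Not at hKμ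
  by_cases hent : ContextualBandit.seqEntropy (β / 2) F T = ⊤
  · refine ⟨hS₀.some, fun Ω _ P _ A => ?_⟩
    have h : ENNReal.ofReal (8 / μ) ≠ 0 := by
      simpa using by positivity
    simp [hent, ENNReal.mul_top h]
  by_cases hint : ∫⁻ ε in Set.Icc α β, ContextualBandit.seqEntropy ε F T ^ (1 / 2 : ℝ) = ⊤
  · refine ⟨hS₀.some, fun Ω _ P _ A => ?_⟩
    have h1 : ENNReal.ofReal (1 / γ) ≠ 0 := by
      simpa using by positivity
    have h2 : ENNReal.ofReal (24 * Real.exp 1 * Real.sqrt (K * T / μ)) ≠ 0 := by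
      rw [Ne, ENNReal.ofReal_eq_zero, not_le]
      positivity
    rw [hint, ENNReal.mul_top h2, add_top, ENNReal.mul_top h1, add_top]
    exact le_top
  obtain ⟨S, hS⟩ := ContextualBandit.exists_strategy_of_entropy hK hT hF hα hαβ hμ0 hKμ hγ
    hent hint
  refine ⟨S, fun Ω _ P _ A => ?_⟩
  set L := ContextualBandit.seqEntropy (β / 2) F T
  set I := ∫⁻ ε in Set.Icc α β, ContextualBandit.seqEntropy ε F T ^ (1 / 2 : ℝ)
  have hL : L = ENNReal.ofReal L.toReal := (ENNReal.ofReal_toReal hent).symm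
  have hI : I = ENNReal.ofReal I.toReal := (ENNReal.ofReal_toReal hint).symm
  have hL0 : 0 ≤ L.toReal := ENNReal.toReal_nonneg
  have hI0 : 0 ≤ I.toReal := ENNReal.toReal_nonneg
  have e1 : 4 * (2 * (K : ℝ≥0∞) ^ 2 * T * L) ^ (1 / 2 : ℝ) =
      ENNReal.ofReal (4 * √(2 * K ^ 2 * T * L.toReal)) := by
    have h : (2 * (K : ℝ≥0∞) ^ 2 * T * L).toReal = 2 * K ^ 2 * T * L.toReal := by simp
    rw [← h, ContextualBandit.ofReal_mul_sqrt_toReal (by norm_num)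
      (ENNReal.mul_ne_top (by finiteness) hent)]
    simp
  have e2 : ENNReal.ofReal (8 / μ) * L = ENNReal.ofReal (8 / μ * L.toReal) := by
    rw [ENNReal.ofReal_mul (by positivity), ← hL]
  have e3 : ENNReal.ofReal (1 / γ) * (ENNReal.ofReal (3 * Real.exp 1 ^ 2 * α * K * T)
      + ENNReal.ofReal (24 * Real.exp 1 * Real.sqrt (K * T / μ)) * I) =
      ENNReal.ofReal (1 / γ * (3 * Real.exp 1 ^ 2 * α * K * T +
        24 * Real.exp 1 * √(K * T / μ) * I.toReal)) := by
    rw [ENNReal.ofReal_mul (p := 1 / γ) (by positivity),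
      ENNReal.ofReal_add (by positivity) (by positivity), ENNReal.ofReal_mul (q := I.toReal) (by positivity), ← hI]
  rw [e1, e2, e3, add_assoc, add_assoc, add_assoc, ← ENNReal.ofReal_add (by positivity)
    (by positivity), ← ENNReal.ofReal_add (by positivity) (by positivity),
    ← ENNReal.ofReal_add (by positivity) (by positivity), ENNReal.iInf_add]
  refine le_iInf fun f => ?_
  by_cases hf : f ∈ F
  · rw [ciInf_pos hf]
    refine ContextualBandit.expectation_le_of_forall_adversary P S A T
      (fun B a => (B.cumLoss_mem a).1) (fun B a => B.marginLoss_nonneg γ f a) fun B => ?_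
    refine (hS B f hf).trans (le_of_eq ?_)
    ring
  · simp [hf]
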